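/- Let $d\ge 1$ and $n\ge 0$ be integers, let $q$ be an indeterminate, and let ${\rm Y}_{d,n}(q)$ be the Yokonuma–Hecke algebra, that is, the associative unital $\mathbb C[q,q^{-1}]$-algebra generated by $g_1,\dots,g_{n-1},t_1,\dots,t_n$ subject to the relations $$g_ig_j=g_jg_i\ (|i-j|>1),\qquad g_ig_{i+1}g_i=g_{i+1}g_ig_{i+1},\qquad t_it_j=t_jt_i,\qquad t_jg_i=g_it_{s_i(j)},\qquad t_j^d=1,$$ $$g_i^2=1+(q-q^{-1})\,e_i\,g_i,\qquad\text{where } e_i:=\frac1d\sum_{s=0}^{d-1}t_i^{s}t_{i+1}^{-s}\ \text{ and }\ s_i=(i,i+1).$$ Its Jucys–Murphy elements are $t_1,\dots,t_n,J_1,\dots,J_n$, where $J_1:=1$ and $J_{i+1}:=g_iJ_ig_i$ for $1\le i\le n-1$. Put $\mathbb C(q){\rm Y}_{d,n}(q):=\mathbb C(q)\otimes_{\mathbb C[q,q^{-1}]}{\rm Y}_{d,n}(q)$. The spectrum ${\rm Spec}_{\rm JM}$ of the Jucys–Murphy elements is the set of all $2\times n$ arrays $$\begin{pmatrix}\mathsf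 a_1&\dots&\mathsf a_n\\ \mathsf c_1&\dots&\mathsf c_n\end{pmatrix}$$ with entries in $\mathbb C(q)$ for which there are a representation $V$ of $\mathbb C(q){\rm Y}_{d,n}(q)$ and a vector $v\in V$, $v\neq 0$, such that * all the elements $t_1,\dots,t_n,J_1,\dots,J_n$ act on $V$ by diagonalisable operators; * for every $i=1,\dots,n-1$, the action on $V$ of the subalgebra of $\mathbb C(q){\rm Y}_{d,n}(q)$ generated by $t_i,t_{i+1},J_i,J_{i+1},g_i$ is completely reducible; * $t_i(v)=\mathsf a_i v$ and $J_i(v)=\mathsf c_i v$ for all $i=1,\dots,n$. A $d$-partition of $n$ is a $d$-tuple $\boldsymbol\lambda=(\lambda^{(1)},\dots,\lambda^{(d)})$ of partitions (Young diagrams) with $n$ nodes in total. A standard $d$-tableau of size $n$ is a $d$-partition $\boldsymbol\lambda$ of $n$ together with a bijection between $\{1,\dots,n\}$ and the set of nodes of $\boldsymbol\lambda$ such that the entries increase along every row and down every column of every diagram of $\boldsymbol\lambda$. If, in the standard $d$-tableau $\mathcal T$, the number $i$ is in row $x$ and column $y$ of the $k$-th diagram, put ${\rm p}(\mathcal T|i):=k$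 and ${\rm c}(\mathcal T|i):=q^{2(y-x)}$. **Proposition 5.4.** Let $\xi_1,\dots,\xi_d$ be the $d$-th roots of unity in $\mathbb C$, in any order. The map $$\mathcal T\longmapsto\begin{pmatrix}\xi_{{\rm p}(\mathcal T|1)}&\dots&\xi_{{\rm p}(\mathcal T|n)}\\ {\rm c}(\mathcal T|1)&\dots&{\rm c}(\mathcal T|n)\end{pmatrix}$$ is a bijection from the set of standard $d$-tableaux of size $n$ (of any shape) onto ${\rm Spec}_{\rm JM}$. -/

import Mathlib

open scoped TensorProduct

noncomputable section

namespace YokonumaHecke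

/-! ### The base rings -/

/-- The ring `ℂ[q, q⁻¹]`. -/
abbrev BaseRing : Type := LaurentPolynomial ℂ

/-- The indeterminate `q` of `ℂ[q, q⁻¹]`. -/
def qL : BaseRing := LaurentPolynomial.T 1

/-- The inverse `q⁻¹` of the indeterminate in `ℂ[q, q⁻¹]`. -/
def qLinv : BaseRing := LaurentPolynomial.T (-1)

/-- The field `ℂ(q)`, as the field of fractions of `ℂ[q, q⁻¹]`. -/
abbrev BaseField : Type := FractionRing BaseRing

/-- The indeterminate `q` of `ℂ(q)`. -/
def q : BaseField := algebraMap BaseRing BaseField qL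

/-! ### The Yokonuma–Hecke algebra

All indices start at `0`: `t i` for `i : Fin n` is the `(i+1)`-st framing generator, and `g i` for
`i : Fin (n - 1)` is the `(i+1)`-st braiding generator, attached to the transposition of
`left i` and `right i`. -/

/-- The index `i`, viewed among the `n` strands. -/
def left {n : ℕ} (i : Fin (n - 1)) : Fin n := ⟨i, by have := i.2; omega⟩

/-- The index `i + 1`, viewed among the `n` strands. -/
def right {n : ℕ} (i : Fin (n - 1)) : Fin n := ⟨i + 1, by have := i.2; omega⟩

/-- The names of the generators `g_1, …, g_{n-1}, t_1, …, t_n`. -/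
inductive Gen (n : ℕ) : Type
  | g : Fin (n - 1) → Gen n
  | t : Fin n → Gen n

/-- The free `ℂ[q, q⁻¹]`-algebra on the generators. -/
abbrev Free (n : ℕ) : Type := FreeAlgebra BaseRing (Gen n)

/-- The generator `g_i` in the free algebra. -/
def Free.g {n : ℕ} (i : Fin (n - 1)) : Free n := FreeAlgebra.ι BaseRing (Gen.g i)

/-- The generator `t_j` in the free algebra. -/
def Free.t {n : ℕ} (j : Fin n) : Free n := FreeAlgebra.ι BaseRing (Gen.t j)

/-- A lift of `e_i = (1/d) ∑_{s=0}^{d-1} t_i^s t_{i+1}^{-s}` to the free algebra. Since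
`t_{i+1}^d = 1` in the quotient, `t_{i+1}^{-s}` is written `t_{i+1}^{d-s}`, where `s < d`. -/
def Free.e (d : ℕ) {n : ℕ} (i : Fin (n - 1)) : Free n :=
  algebraMap ℂ BaseRing ((d : ℂ)⁻¹) •
    ∑ s ∈ Finset.range d, Free.t (left i) ^ s * Free.t (right i) ^ (d - s)

/-- The defining relations of the Yokonuma–Hecke algebra. -/
inductive Rel (d n : ℕ) : Free n → Free n → Prop
  | braid_comm (i j : Fin (n - 1)) (h : 1 < |((i : ℕ) : ℤ) - ((j : ℕ) : ℤ)|) :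
      Rel d n (Free.g i * Free.g j) (Free.g j * Free.g i)
  | braid (i j : Fin (n - 1)) (h : (j : ℕ) = i + 1) :
      Rel d n (Free.g i * Free.g j * Free.g i) (Free.g j * Free.g i * Free.g j)
  | frame_comm (i j : Fin n) : Rel d n (Free.t i * Free.t j) (Free.t j * Free.t i)
  | frame_braid (i : Fin (n - 1)) (j : Fin n) :
      Rel d n (Free.t j * Free.g i) (Free.g i * Free.t (Equiv.swap (left i) (right i) j))
  | frame_pow (j : Fin n) : Rel d n (Free.t j ^ d) 1
  | quadratic (i : Fin (n - 1)) :
      Rel d n (Free.g i ^ 2) (1 + (qL - qLinv) • (Free.e d i * Free.g i))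

/-- The Yokonuma–Hecke algebra `Y_{d,n}(q)` over `ℂ[q, q⁻¹]`. -/
abbrev Y (d n : ℕ) : Type := RingQuot (Rel d n)

/-- The generator `g_i` of `Y_{d,n}(q)`. -/
def g (d : ℕ) {n : ℕ} (i : Fin (n - 1)) : Y d n :=
  RingQuot.mkAlgHom BaseRing (Rel d n) (Free.g i)

/-- The generator `t_j` of `Y_{d,n}(q)`. -/
def t (d : ℕ) {n : ℕ} (j : Fin n) : Y d n :=
  RingQuot.mkAlgHom BaseRing (Rel d n) (Free.t j)

/-- The recursion `J_1 = 1`, `J_{i+1} = g_i J_i g_i`, with indices shifted to start at `0`. -/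
def jucysMurphyAux (d n : ℕ) : (k : ℕ) → k < n → Y d n
  | 0, _ => 1
  | k + 1, h =>
      g d (⟨k, by omega⟩ : Fin (n - 1)) * jucysMurphyAux d n k (by omega) *
        g d (⟨k, by omega⟩ : Fin (n - 1))

/-- The Jucys–Murphy elements `J_1, …, J_n` of `Y_{d,n}(q)`. -/
def J (d : ℕ) {n : ℕ} (i : Fin n) : Y d n := jucysMurphyAux d n i i.2

/-! ### Extension of scalars to `ℂ(q)` and the spectrum -/

/-- The algebra `ℂ(q) Y_{d,n}(q) = ℂ(q) ⊗ Y_{d,n}(q)`. -/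
abbrev YK (d n : ℕ) : Type := BaseField ⊗[BaseRing] Y d n

/-- The canonical map from `Y_{d,n}(q)` to `ℂ(q) Y_{d,n}(q)`. -/
def incl (d n : ℕ) : Y d n →ₐ[BaseRing] YK d n := Algebra.TensorProduct.includeRight

/-- A linear operator is diagonalisable if its eigenvectors span the space. -/
def IsDiagonalisable {V : Type*} [AddCommGroup V] [Module BaseField V]
    (f : Module.End BaseField V) : Prop :=
  ⨆ μ : BaseField, f.eigenspace μ = ⊤

/-- The subalgebra of `ℂ(q) Y_{d,n}(q)` generated by `t_i, t_{i+1}, J_i, J_{i+1}, g_i`. -/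
def localSubalgebra (d : ℕ) {n : ℕ} (i : Fin (n - 1)) : Subalgebra BaseField (YK d n) :=
  Algebra.adjoin BaseField
    {incl d n (t d (left i)), incl d n (t d (right i)), incl d n (J d (left i)),
      incl d n (J d (right i)), incl d n (g d i)}

/-- The representations of `ℂ(q) Y_{d,n}(q)` that are used to define the spectrum. -/
structure IsAdmissible {d n : ℕ} {V : Type*} [AddCommGroup V] [Module BaseField V]
    (ρ : YK d n →ₐ[BaseField] Module.End BaseField V) : Prop where
  /-- All `t_i` are represented by diagonalisable operators. -/
  diag_t : ∀ i : Fin n, IsDiagonalisable (ρ (incl d n (t d i)))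
  /-- All `J_i` are represented by diagonalisable operators. -/
  diag_J : ∀ i : Fin n, IsDiagonalisable (ρ (incl d n (J d i)))
  /-- For all `i < n`, the action on `V` of the subalgebra generated by
  `t_i, t_{i+1}, J_i, J_{i+1}, g_i` is completely reducible. -/
  semisimple : ∀ i : Fin (n - 1), IsSemisimpleModule ((localSubalgebra d i).map ρ) V

/-- Arrays with two rows of length `n` and entries in `ℂ(q)`: `Λ.1` is the first row
`a_1, …, a_n` and `Λ.2` is the second row `c_1, …, c_n`. -/
abbrev Array2 (n : ℕ) : Type := (Fin n → BaseField) × (Fin n → BaseField)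

/-- The spectrum of `t_1, …, t_n, J_1, …, J_n`: the arrays of eigenvalues of their common
eigenvectors in admissible representations. -/
def Spec (d n : ℕ) : Set (Array2 n) :=
  {Λ | ∃ (V : Type) (_ : AddCommGroup V) (_ : Module BaseField V)
      (ρ : YK d n →ₐ[BaseField] Module.End BaseField V) (v : V),
      IsAdmissible ρ ∧ v ≠ 0 ∧
        ∀ i : Fin n, ρ (incl d n (t d i)) v = Λ.1 i • v ∧ ρ (incl d n (J d i)) v = Λ.2 i • v}

/-! ### Standard `d`-tableaux -/

/-- A `d`-node: a row `row`, a column `col`, and a position `pos`, all starting at `0`. -/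
@[ext]
structure DNode (d : ℕ) : Type where
  row : ℕ
  col : ℕ
  pos : Fin d

/-- The quantum content `q^{2(y-x)}` of the `d`-node in row `x` and column `y`. -/
def DNode.content {d : ℕ} (θ : DNode d) : BaseField := q ^ (2 * ((θ.col : ℤ) - (θ.row : ℤ)))

/-- A `d`-partition: a `d`-tuple of partitions, seen as Young diagrams. -/
abbrev DPartition (d : ℕ) : Type := Fin d → YoungDiagram

/-- The set of `d`-nodes of a `d`-partition. -/
def DPartition.nodes {d : ℕ} (lam : DPartition d) : Set (DNode d) :=
  {θ | (θ.row, θ.col) ∈ lam θ.pos}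

/-- A standard `d`-tableau of size `n` (of any shape). -/
@[ext]
structure StdTableau (d n : ℕ) : Type where
  /-- The shape. -/
  shape : DPartition d
  /-- The node that contains a given number. -/
  node : Fin n → DNode d
  /-- The placement of the numbers is a bijection onto the nodes of the shape, so that the shape
  has size `n`. -/
  bijOn : Set.BijOn node Set.univ (DPartition.nodes shape)
  /-- The entries increase along rows. -/
  row_lt : ∀ i j : Fin n, (node i).pos = (node j).pos → (node i).row = (node j).row →
    (node i).col < (node j).col → i < j
  /-- The entries increase down columns. -/
  col_lt : ∀ i j : Fin n, (node i).pos = (node j).pos → (node i).col = (node j).col →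
    (node i).row < (node j).row → i < j

/-- The array of a standard `d`-tableau: its `i`-th column consists of the root of unity attached
to the position of the node containing `i`, and of the quantum content of this node. -/
def StdTableau.array {d n : ℕ} (ξ : Fin d → ℂ) (T : StdTableau d n) : Array2 n :=
  (fun i => algebraMap ℂ BaseField (ξ (T.node i).pos), fun i => (T.node i).content)

end YokonumaHecke

end

open scoped TensorProduct

noncomputable section

namespace YokonumaHecke

/-! ### Content arrays -/

/-! Both sides are matched with one combinatorial set. Write a column of eigenvalues `(ξ_p, q^(2c))`
as the letter `(p, c)`. A word of letters is a content array if every letter with `c ≠ 0` is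
preceded by the letter one step closer to content `0`, and if between two equal letters both
neighbouring contents occur at the same position. Reading positions and contents off a standard
tableau gives such a word (`isContentArray_letters`). The word determines the tableau
(`letters_injective`), and every content array arises in this way, since each successive letter can
be put at the first free place of its diagonal (`IsContentArray.exists_letters_eq`).

Spectrum implies content array. Fix an admissible representation and a common eigenvector `v`. The
commutation of `g_i` with the Jucys–Murphy elements shows that a suitable `g_i v - b v` is either
zero or a common eigenvector with columns `i` and `i + 1` exchanged. Four facts follow. The first
Jucys–Murphy eigenvalue is `1`. Neighbouring columns differ, since otherwise a Jordan block would
appear (`JointEigen.ne`). Neighbouring columns that are not related by a factor `q²` can be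
exchanged inside the spectrum of the representation (`JointEigen.exists_swap`). If they are related,
complete reducibility makes `v` an eigenvector of `g_i`, and the braid relation then forbids a
pattern `a b a` with `a`, `b` related (`JointEigen.ne_of_related`). A purely combinatorial argument
turns these facts into the content conditions (`isContentArray_of_swap_mem`); it moves letters by
permitted exchanges.

Content array implies spectrum. On the space with basis all content arrays, seminormal formulas
define operators that satisfy the relations of the algebra (`isRep_seminormal`), with each basis
vector a common eigenvector having the required eigenvalues (`jm_semG_basisVec`). Each local algebra
preserves the span of a basis vector and its transposed vector, whence complete reducibility
(`isSemisimpleModule_seminormal`). -/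

/-- The combinatorial characterisation of the arrays of positions and (logarithmic) contents of
standard `d`-tableaux. -/
structure IsContentArray {d n : ℕ} (x : Fin n → Fin d × ℤ) : Prop where
  pos : ∀ j, 0 < (x j).2 → ∃ i < j, x i = ((x j).1, (x j).2 - 1)
  neg : ∀ j, (x j).2 < 0 → ∃ i < j, x i = ((x j).1, (x j).2 + 1)
  up : ∀ i j, i < j → x i = x j → ∃ l, i < l ∧ l < j ∧ x l = ((x i).1, (x i).2 + 1)
  down : ∀ i j, i < j → x i = x j → ∃ l, i < l ∧ l < j ∧ x l = ((x i).1, (x i).2 - 1)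

/-- Two letters are adjacent if they have the same position and contents differing by one. -/
def Adjacent {d : ℕ} (a b : Fin d × ℤ) : Prop := a.1 = b.1 ∧ (b.2 = a.2 + 1 ∨ a.2 = b.2 + 1)

theorem Adjacent.symm {d : ℕ} {a b : Fin d × ℤ} (h : Adjacent a b) : Adjacent b a :=
  ⟨h.1.symm, h.2.symm⟩

/-! ### Content arrays of standard tableaux -/

namespace StdTableau

variable {d n : ℕ}

/-- The positions and the contents of the entries of a tableau. -/
def letters (T : StdTableau d n) (j : Fin n) : Fin d × ℤ :=
  ((T.node j).pos, ((T.node j).col : ℤ) - (T.node j).row)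

theorem node_injective (T : StdTableau d n) : Function.Injective T.node := fun _ _ h =>
  T.bijOn.injOn (Set.mem_univ _) (Set.mem_univ _) h

theorem node_mem (T : StdTableau d n) (j : Fin n) :
    ((T.node j).row, (T.node j).col) ∈ T.shape (T.node j).pos :=
  T.bijOn.mapsTo (Set.mem_univ j)

theorem exists_node_eq (T : StdTableau d n) {r c : ℕ} {p : Fin d} (h : (r, c) ∈ T.shape p) :
    ∃ l, T.node l = ⟨r, c, p⟩ := by
  obtain ⟨l, -, hl⟩ := T.bijOn.surjOn (show (⟨r, c, p⟩ : DNode d) ∈ DPartition.nodes T.shape from h)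
  exact ⟨l, hl⟩

/-- Entries are compared through the corner `(r, (T.node j).col)`: along a row to the corner, then
down the column to the node of `j`. -/
theorem exists_le_node_eq (T : StdTableau d n) (j : Fin n) {r c : ℕ} (hr : r ≤ (T.node j).row)
    (hc : c ≤ (T.node j).col) : ∃ l ≤ j, T.node l = ⟨r, c, (T.node j).pos⟩ := by
  have hm := T.node_mem j
  obtain ⟨m, hm'⟩ := T.exists_node_eq
    (YoungDiagram.up_left_mem _ hr le_rfl hm : (r, (T.node j).col) ∈ T.shape (T.node j).pos)
  obtain ⟨l, hl⟩ := T.exists_node_eq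
    (YoungDiagram.up_left_mem _ hr hc hm : (r, c) ∈ T.shape (T.node j).pos)
  refine ⟨l, le_trans (b := m) ?_ ?_, hl⟩
  · rcases hc.eq_or_lt with h | h
    · exact (T.node_injective (by rw [hl, hm', h])).le
    · exact (T.row_lt l m (by simp [hl, hm']) (by simp [hl, hm']) (by simpa [hl, hm'])).le
  · rcases hr.eq_or_lt with h | h
    · exact (T.node_injective (by rw [hm', h])).le
    · exact (T.col_lt m j (by simp [hm']) (by simp [hm']) (by simpa [hm'])).le

theorem le_of_node_le (T : StdTableau d n) {i j : Fin n} (hp : (T.node i).pos = (T.node j).pos)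
    (hr : (T.node i).row ≤ (T.node j).row) (hc : (T.node i).col ≤ (T.node j).col) : i ≤ j := by
  obtain ⟨l, hl, h⟩ := T.exists_le_node_eq j hr hc
  have : l = i := T.node_injective (by rw [h, ← hp])
  exact this ▸ hl

theorem lt_of_node_eq (T : StdTableau d n) {l j : Fin n} {θ : DNode d} (hl : l ≤ j)
    (h : T.node l = θ) (hne : θ ≠ T.node j) : l < j :=
  lt_of_le_of_ne hl (by rintro rfl; exact hne h.symm)

theorem isContentArray_letters (T : StdTableau d n) : IsContentArray T.letters := by
  -- Of two entries on one diagonal of one diagram, the later lies strictly to the south-east. The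
  -- nodes right of and below the earlier one then carry intermediate entries.
  have key : ∀ i j, i < j → T.letters i = T.letters j →
      (T.node i).pos = (T.node j).pos ∧ (T.node i).row + 1 ≤ (T.node j).row ∧
      (T.node i).col + 1 ≤ (T.node j).col := by
    intro i j hij h
    simp only [letters, Prod.mk.injEq] at h
    obtain ⟨h1, h2⟩ := h
    have : ¬ (T.node j).row ≤ (T.node i).row := fun hr =>
      absurd (T.le_of_node_le h1.symm hr (by omega)) (not_le.2 hij)
    exact ⟨h1, by omega, by omega⟩
  refine ⟨fun j hj => ?_, fun j hj => ?_, fun i j hij h => ?_, fun i j hij h => ?_⟩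
  · simp only [letters] at hj
    obtain ⟨l, hl, h⟩ := T.exists_le_node_eq j (r := (T.node j).row) (c := (T.node j).col - 1)
      le_rfl (by omega)
    refine ⟨l, T.lt_of_node_eq hl h ?_, ?_⟩
    · intro h'; have := congrArg DNode.col h'; simp only at this; omega
    · simp only [letters, h, Prod.mk.injEq, true_and]; omega
  · simp only [letters] at hj
    obtain ⟨l, hl, h⟩ := T.exists_le_node_eq j (r := (T.node j).row - 1) (c := (T.node j).col)
      (by omega) le_rfl
    refine ⟨l, T.lt_of_node_eq hl h ?_, ?_⟩
    · intro h'; have := congrArg DNode.row h'; simp only at this; omega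
    · simp only [letters, h, Prod.mk.injEq, true_and]; omega
  · obtain ⟨h1, h2, h3⟩ := key i j hij h
    obtain ⟨l, hl, h⟩ := T.exists_le_node_eq j (r := (T.node i).row) (c := (T.node i).col + 1)
      (by omega) h3
    refine ⟨l, T.row_lt i l (by simp [h, h1]) (by simp [h]) (by simp [h]),
      T.lt_of_node_eq hl h ?_, ?_⟩
    · intro h'; have := congrArg DNode.row h'; simp only at this; omega
    · simp only [letters, h, Prod.mk.injEq, h1, true_and]; omega
  · obtain ⟨h1, h2, h3⟩ := key i j hij h
    obtain ⟨l, hl, h⟩ := T.exists_le_node_eq j (r := (T.node i).row + 1) (c := (T.node i).col)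
      h2 (by omega)
    refine ⟨l, T.col_lt i l (by simp [h, h1]) (by simp [h]) (by simp [h]),
      T.lt_of_node_eq hl h ?_, ?_⟩
    · intro h'; have := congrArg DNode.col h'; simp only at this; omega
    · simp only [letters, h, Prod.mk.injEq, h1, true_and]; omega

/-- Both nodes of `j` lie on one diagonal. If that of `T` were the higher one, it would be occupied
in `T'` by some `l < j`, hence also in `T` by `l`, although `T` puts `j` there. -/
theorem not_row_lt_of_letters_eq {T T' : StdTableau d n} (h : T.letters = T'.letters) {j : Fin n}
    (ih : ∀ i < j, T.node i = T'.node i) : ¬ (T.node j).row < (T'.node j).row := by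
  intro hr
  have hj := congrFun h j
  simp only [letters, Prod.mk.injEq] at hj
  obtain ⟨l, hl, hl'⟩ := T'.exists_le_node_eq j (r := (T.node j).row) (c := (T.node j).col)
    hr.le (by omega)
  have hlj : l < j := T'.lt_of_node_eq hl hl' (by
    intro h'; have := congrArg DNode.row h'; simp only at this; omega)
  have : l = j := T.node_injective (by rw [ih l hlj, hl', ← hj.1])
  omega

theorem letters_injective : Function.Injective (letters : StdTableau d n → _) := by
  intro T T' h
  have hnode : ∀ j, T.node j = T'.node j := by
    intro j
    induction j using WellFoundedLT.induction with
    | ind j ih =>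
      have h1 := not_row_lt_of_letters_eq h ih
      have h2 := not_row_lt_of_letters_eq h.symm (fun i hi => (ih i hi).symm)
      have hj := congrFun h j
      simp only [letters, Prod.mk.injEq] at hj
      ext1
      · omega
      · omega
      · exact hj.1
  refine StdTableau.ext ?_ (funext hnode)
  funext p
  ext ⟨r, c⟩
  have himg : DPartition.nodes T.shape = DPartition.nodes T'.shape := by
    rw [← T.bijOn.image_eq, ← T'.bijOn.image_eq, funext hnode]
  exact Set.ext_iff.1 himg ⟨r, c, p⟩

theorem mem_shape_of_node_eq (T : StdTableau d n) {l : Fin n} {r c : ℕ} {p : Fin d}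
    (h : T.node l = ⟨r, c, p⟩) : (r, c) ∈ T.shape p := by
  have := T.node_mem l
  simpa [h] using this

/-- Adding a node to a standard tableau. -/
theorem exists_snoc (T : StdTableau d n) (r c : ℕ) (p : Fin d) (hnot : (r, c) ∉ T.shape p)
    (hr : ∀ r', r = r' + 1 → (r', c) ∈ T.shape p) (hc : ∀ c', c = c' + 1 → (r, c') ∈ T.shape p) :
    ∃ T' : StdTableau d (n + 1), (∀ i : Fin n, T'.node i.castSucc = T.node i) ∧
      T'.node (Fin.last n) = ⟨r, c, p⟩ := by
  classical
  let mu : YoungDiagram := ⟨insert (r, c) (T.shape p).cells, by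
    rintro ⟨r₁, c₁⟩ ⟨r₂, c₂⟩ h hm
    simp only [Prod.mk_le_mk] at h
    simp only [Finset.coe_insert, Set.mem_insert_iff, Finset.mem_coe, YoungDiagram.mem_cells,
      Prod.mk.injEq] at hm ⊢
    rcases hm with ⟨rfl, rfl⟩ | hm
    · rcases h.1.lt_or_eq with h1 | h1
      · obtain ⟨k, rfl⟩ : ∃ k, r₁ = k + 1 := ⟨r₁ - 1, by omega⟩
        exact Or.inr (YoungDiagram.up_left_mem _ (by omega) h.2 (hr k rfl))
      · rcases h.2.lt_or_eq with h2 | h2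
        · obtain ⟨k, rfl⟩ : ∃ k, c₁ = k + 1 := ⟨c₁ - 1, by omega⟩
          exact Or.inr (YoungDiagram.up_left_mem _ h.1 (by omega) (hc k rfl))
        · exact Or.inl ⟨h1, h2⟩
    · exact Or.inr (YoungDiagram.up_left_mem _ h.1 h.2 hm)⟩
  have hmu : ∀ a, a ∈ mu ↔ a = (r, c) ∨ a ∈ T.shape p := by
    intro a
    rw [← YoungDiagram.mem_cells]
    simp [mu]
  let node : Fin (n + 1) → DNode d := Fin.snoc T.node ⟨r, c, p⟩
  have hn1 : ∀ i : Fin n, node i.castSucc = T.node i := fun i => by simp [node]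
  have hn2 : node (Fin.last n) = ⟨r, c, p⟩ := by simp [node]
  have hne : ∀ i, T.node i ≠ ⟨r, c, p⟩ := fun i h => hnot (T.mem_shape_of_node_eq h)
  have hmem : ∀ θ : DNode d, θ ∈ DPartition.nodes (Function.update T.shape p mu) ↔
      θ = ⟨r, c, p⟩ ∨ θ ∈ DPartition.nodes T.shape := by
    rintro ⟨r', c', p'⟩
    simp only [DPartition.nodes, Set.mem_ofPred_eq, DNode.mk.injEq]
    by_cases h : p' = p
    · subst h; simp [hmu]
    · simp [h]
  have hout : ∀ i : Fin n, (T.node i).pos = p → r ≤ (T.node i).row → c ≤ (T.node i).col → False := by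
    rintro i rfl h1 h2
    exact hnot (YoungDiagram.up_left_mem _ h1 h2 (T.node_mem i))
  refine ⟨⟨Function.update T.shape p mu, node, ⟨?_, ?_, ?_⟩, ?_, ?_⟩, hn1, hn2⟩
  · intro i _
    rw [hmem]
    induction i using Fin.lastCases with
    | last => exact Or.inl hn2
    | cast i => rw [hn1]; exact Or.inr (T.node_mem i)
  · intro i _ j _ h
    induction i using Fin.lastCases with
    | last =>
      induction j using Fin.lastCases with
      | last => rfl
      | cast j => rw [hn1, hn2] at h; exact absurd h.symm (hne j)
    | cast i =>
      induction j using Fin.lastCases with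
      | last => rw [hn1, hn2] at h; exact absurd h (hne i)
      | cast j => rw [hn1, hn1] at h; rw [T.node_injective h]
  · intro θ hθ
    rcases (hmem θ).1 hθ with rfl | h
    · exact ⟨Fin.last n, Set.mem_univ _, hn2⟩
    · obtain ⟨l, hl⟩ := T.exists_node_eq (r := θ.row) (c := θ.col) (p := θ.pos) h
      exact ⟨l.castSucc, Set.mem_univ _, by rw [hn1, hl]⟩
  · intro i j
    induction i using Fin.lastCases with
    | last =>
      induction j using Fin.lastCases with
      | last => intro _ _ h; exact absurd h (lt_irrefl _)
      | cast j =>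
        rw [hn1, hn2]; intro h1 h2 h3
        exact (hout j h1.symm (le_of_eq h2) h3.le).elim
    | cast i =>
      induction j using Fin.lastCases with
      | last => intro _ _ _; exact Fin.castSucc_lt_last i
      | cast j => rw [hn1, hn1]; exact T.row_lt i j
  · intro i j
    induction i using Fin.lastCases with
    | last =>
      induction j using Fin.lastCases with
      | last => intro _ _ h; exact absurd h (lt_irrefl _)
      | cast j =>
        rw [hn1, hn2]; intro h1 h2 h3
        exact (hout j h1.symm h3.le (le_of_eq h2)).elim
    | cast i =>
      induction j using Fin.lastCases with
      | last => intro _ _ _; exact Fin.castSucc_lt_last i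
      | cast j => rw [hn1, hn1]; exact T.col_lt i j

end StdTableau

/-! ### Reconstruction of a tableau from a content array -/

open StdTableau

theorem IsContentArray.castSucc {d n : ℕ} {x : Fin (n + 1) → Fin d × ℤ} (hx : IsContentArray x) :
    IsContentArray fun i : Fin n => x i.castSucc := by
  refine ⟨fun j hj => ?_, fun j hj => ?_, fun i j hij h => ?_, fun i j hij h => ?_⟩
  · obtain ⟨i, hi, h⟩ := hx.pos j.castSucc hj
    exact ⟨i.castPred (Fin.ne_last_of_lt hi), Fin.castPred_lt_iff _ |>.2 hi, by simpa using h⟩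
  · obtain ⟨i, hi, h⟩ := hx.neg j.castSucc hj
    exact ⟨i.castPred (Fin.ne_last_of_lt hi), Fin.castPred_lt_iff _ |>.2 hi, by simpa using h⟩
  · obtain ⟨l, h1, h2, h3⟩ := hx.up i.castSucc j.castSucc hij h
    exact ⟨l.castPred (Fin.ne_last_of_lt h2), h1, h2, by simpa using h3⟩
  · obtain ⟨l, h1, h2, h3⟩ := hx.down i.castSucc j.castSucc hij h
    exact ⟨l.castPred (Fin.ne_last_of_lt h2), h1, h2, by simpa using h3⟩

theorem IsContentArray.exists_letters_eq {d : ℕ} : ∀ {n : ℕ} {x : Fin n → Fin d × ℤ},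
    IsContentArray x → ∃ T : StdTableau d n, T.letters = x
  | 0, x, _ => ⟨⟨fun _ => ⊥, Fin.elim0, ⟨fun i => i.elim0, fun i => i.elim0, by
      rintro ⟨r, c, p⟩ h; simp [DPartition.nodes] at h⟩,
      fun i => i.elim0, fun i => i.elim0⟩, funext fun i => i.elim0⟩
  | n + 1, x, hx => by
    classical
    obtain ⟨T, hT⟩ := hx.castSucc.exists_letters_eq
    obtain ⟨p, c, hlast⟩ : ∃ p c, x (Fin.last n) = (p, c) := ⟨_, _, rfl⟩
    have hT' : ∀ i : Fin n, ((T.node i).pos, ((T.node i).col : ℤ) - (T.node i).row) =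
        x i.castSucc := fun i => congrFun hT i
    -- As `k` varies, these nodes run down the diagonal of content `c`, starting on the border of
    -- the quadrant; finiteness of the diagram yields a first free one.
    have hex : ∃ k, (k + (-c).toNat, k + c.toNat) ∉ T.shape p := by
      by_contra! hall
      have hinj : Function.Injective fun k : ℕ => (k + (-c).toNat, k + c.toNat) := by
        intro a b h; simp only [Prod.mk.injEq] at h; omega
      exact Set.infinite_of_injective_forall_mem hinj (s := ((T.shape p).cells : Set (ℕ × ℕ)))
        (fun k => (YoungDiagram.mem_cells _).2 (hall k)) (Finset.finite_toSet _)
    obtain ⟨k, hk, hmin⟩ : ∃ k, (k + (-c).toNat, k + c.toNat) ∉ T.shape p ∧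
        ∀ m < k, (m + (-c).toNat, m + c.toNat) ∈ T.shape p :=
      ⟨Nat.find hex, Nat.find_spec hex, fun m hm => not_not.1 (Nat.find_min hex hm)⟩
    have hadd : (∀ r', k + (-c).toNat = r' + 1 → (r', k + c.toNat) ∈ T.shape p) ∧
        (∀ c', k + c.toNat = c' + 1 → (k + (-c).toNat, c') ∈ T.shape p) := by
      -- On the border, the condition `neg` or `pos` supplies the only neighbour needed. Further
      -- down, the previous node of the diagonal holds an equal letter, and `up` and `down` supply
      -- the nodes above and to the left.
      rcases Nat.eq_zero_or_pos k with rfl | hkpos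
      · constructor
        · intro r' hr'
          obtain ⟨i, hi, h⟩ := hx.neg (Fin.last n) (by rw [hlast]; simp only; omega)
          obtain ⟨i, rfl⟩ := Fin.exists_castSucc_eq.2 (Fin.ne_last_of_lt hi)
          rw [← hT', hlast] at h
          simp only [Prod.mk.injEq] at h
          have := T.node_mem i
          rw [h.1] at this
          exact YoungDiagram.up_left_mem _ (by omega) (by omega) this
        · intro r' hr'
          obtain ⟨i, hi, h⟩ := hx.pos (Fin.last n) (by rw [hlast]; simp only; omega)
          obtain ⟨i, rfl⟩ := Fin.exists_castSucc_eq.2 (Fin.ne_last_of_lt hi)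
          rw [← hT', hlast] at h
          simp only [Prod.mk.injEq] at h
          have := T.node_mem i
          rw [h.1] at this
          exact YoungDiagram.up_left_mem _ (by omega) (by omega) this
      · obtain ⟨i, hi⟩ := T.exists_node_eq (hmin (k - 1) (by omega))
        have hxi : x i.castSucc = x (Fin.last n) := by
          rw [← hT', hlast, hi]; simp only [Prod.mk.injEq, true_and]; omega
        constructor
        · intro r' hr'
          obtain ⟨l, h1, h2, h3⟩ := hx.up _ _ (Fin.castSucc_lt_last i) hxi
          obtain ⟨l, rfl⟩ := Fin.exists_castSucc_eq.2 (Fin.ne_last_of_lt h2)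
          rw [hxi, ← hT', hlast] at h3
          simp only [Prod.mk.injEq] at h3
          -- Since `l` comes after `i`, its node is not weakly north-west of the node of `i`. As it
          -- lies on the next diagonal, it is weakly south-east of the node above the new one.
          have h4 : ¬ ((T.node l).row < k - 1 + (-c).toNat) := fun h =>
            absurd (T.le_of_node_le (i := l) (j := i) (by simp [h3.1, hi]) (by simp [hi]; omega)
              (by simp [hi]; omega)) (not_le.2 h1)
          have := T.node_mem l
          rw [h3.1] at this
          exact YoungDiagram.up_left_mem _ (by omega) (by omega) this
        · intro r' hr'
          obtain ⟨l, h1, h2, h3⟩ := hx.down _ _ (Fin.castSucc_lt_last i) hxi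
          obtain ⟨l, rfl⟩ := Fin.exists_castSucc_eq.2 (Fin.ne_last_of_lt h2)
          rw [hxi, ← hT', hlast] at h3
          simp only [Prod.mk.injEq] at h3
          have h4 : ¬ ((T.node l).col < k - 1 + c.toNat) := fun h =>
            absurd (T.le_of_node_le (i := l) (j := i) (by simp [h3.1, hi]) (by simp [hi]; omega)
              (by simp [hi]; omega)) (not_le.2 h1)
          have := T.node_mem l
          rw [h3.1] at this
          exact YoungDiagram.up_left_mem _ (by omega) (by omega) this
    obtain ⟨T', h1, h2⟩ := T.exists_snoc _ _ p hk hadd.1 hadd.2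
    refine ⟨T', funext fun j => ?_⟩
    induction j using Fin.lastCases with
    | last => simp only [letters, h2, hlast, Prod.mk.injEq, true_and]; omega
    | cast j => simp only [letters, h1]; exact hT' j

/-! ### The field `ℂ(q)` -/

theorem algebraMap_T (m : ℤ) :
    algebraMap BaseRing BaseField (LaurentPolynomial.T m) = q ^ m := by
  have hq : q * algebraMap BaseRing BaseField (LaurentPolynomial.T (-1)) = 1 := by
    rw [q, qL, ← map_mul, ← LaurentPolynomial.T_add]; simp
  have hq0 : q ≠ 0 := left_ne_zero_of_mul_eq_one hq
  induction m using Int.induction_on with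
  | zero => simp
  | succ m ih => rw [LaurentPolynomial.T_add, map_mul, ih, zpow_add₀ hq0, zpow_one]; rfl
  | pred m ih =>
    rw [sub_eq_add_neg, LaurentPolynomial.T_add, map_mul, ih, zpow_add₀ hq0, zpow_neg_one,
      eq_inv_of_mul_eq_one_right hq]

theorem q_ne_zero : q ≠ 0 := by
  have := algebraMap_T 1
  rw [zpow_one] at this
  rw [← this, Ne, IsFractionRing.to_map_eq_zero_iff]
  exact (LaurentPolynomial.isUnit_T 1).ne_zero

theorem q_zpow_injective : Function.Injective fun m : ℤ => q ^ m := by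
  intro m m' h
  simp only [← algebraMap_T] at h
  exact AddMonoidAlgebra.single_left_injective one_ne_zero
    (IsFractionRing.injective BaseRing BaseField h)

theorem q_zpow_eq_zpow {m m' : ℤ} : q ^ m = q ^ m' ↔ m = m' := q_zpow_injective.eq_iff

theorem q_zpow_ne_one {m : ℤ} (hm : m ≠ 0) : q ^ m ≠ 1 := by
  rw [← zpow_zero q]; exact fun h => hm (q_zpow_injective h)

/-- The parameter `q - q⁻¹` of the quadratic relation. -/
def kappa : BaseField := q - q⁻¹

theorem algebraMap_qL_sub : algebraMap BaseRing BaseField (qL - qLinv) = kappa := by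
  rw [map_sub, qL, qLinv, algebraMap_T, algebraMap_T, zpow_one, zpow_neg_one, kappa]

theorem kappa_ne_zero : kappa ≠ 0 := by
  intro h
  have h := q_zpow_injective (a₁ := 1) (a₂ := -1) (by simpa [kappa, sub_eq_zero] using h)
  omega

theorem q_sq_ne_neg_one : q ^ 2 ≠ -1 := by
  intro h
  refine q_zpow_ne_one (m := 4) (by norm_num) ?_
  have : q ^ (4 : ℤ) = (q ^ 2) ^ 2 := by rw [← pow_mul]; norm_cast
  rw [this, h]; norm_num

/-! ### Relations -/

section Relations

variable {A : Type*} [Ring A] [Algebra BaseField A] {n : ℕ}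

/-- The element `(1/d) ∑ T_i^s T_{i+1}^{d-s}`. -/
def idem (d : ℕ) (T : Fin n → A) (i : Fin (n - 1)) : A :=
  algebraMap ℂ BaseField ((d : ℂ)⁻¹) • ∑ s ∈ Finset.range d, T (left i) ^ s * T (right i) ^ (d - s)

/-- The Jucys–Murphy elements built from elements `G_i`. -/
def jm (G : Fin (n - 1) → A) : (k : ℕ) → k < n → A
  | 0, _ => 1
  | k + 1, h => G ⟨k, by omega⟩ * jm G k (by omega) * G ⟨k, by omega⟩

/-- The relations of the Yokonuma–Hecke algebra, for elements of a `ℂ(q)`-algebra. -/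
structure IsRep (d : ℕ) (G : Fin (n - 1) → A) (T : Fin n → A) : Prop where
  braid_comm : ∀ i j : Fin (n - 1), 1 < |((i : ℕ) : ℤ) - ((j : ℕ) : ℤ)| → G i * G j = G j * G i
  braid : ∀ i j : Fin (n - 1), (j : ℕ) = i + 1 → G i * G j * G i = G j * G i * G j
  frame_comm : ∀ i j : Fin n, T i * T j = T j * T i
  frame_braid : ∀ (i : Fin (n - 1)) (j : Fin n),
    T j * G i = G i * T (Equiv.swap (left i) (right i) j)
  frame_pow : ∀ j : Fin n, T j ^ d = 1
  quadratic : ∀ i : Fin (n - 1), G i * G i = 1 + kappa • (idem d T i * G i)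

theorem jm_right {R : Type*} [Ring R] (G : Fin (n - 1) → R) (i : Fin (n - 1)) :
    jm G (right i) (right i).2 = G i * jm G (left i) (left i).2 * G i := rfl

theorem map_jm {B : Type*} [Ring B] [Algebra BaseField B] (φ : A →ₐ[BaseField] B)
    (G : Fin (n - 1) → A) : ∀ (k : ℕ) (h : k < n), φ (jm G k h) = jm (fun i => φ (G i)) k h
  | 0, _ => by simp [jm]
  | k + 1, h => by simp [jm, map_jm φ G k]

variable {d : ℕ} {G : Fin (n - 1) → A} {T : Fin n → A}

theorem IsRep.commute_jm_of_lt (h : IsRep d G T) (i : Fin (n - 1)) :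
    ∀ (k : ℕ) (hk : k < n), k < i → Commute (G i) (jm G k hk)
  | 0, _, _ => Commute.one_right _
  | k + 1, hk, hi => by
    have hc : Commute (G i) (G ⟨k, by omega⟩) :=
      h.braid_comm _ _ (by rw [lt_abs]; left; simp only; omega)
    exact (hc.mul_right (h.commute_jm_of_lt i k _ (by omega))).mul_right hc

/-- The essential case is `k = i + 2`: two uses of the braid relation carry `g_i` through `g_{i+1}
g_i J_i g_i g_{i+1}`, because `g_{i+1}` commutes with `J_i`. -/
theorem IsRep.commute_jm_of_gt (h : IsRep d G T) (i : Fin (n - 1)) :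
    ∀ (k : ℕ) (hk : k < n), (i : ℕ) + 1 < k → Commute (G i) (jm G k hk)
  | 0, _, hi => by omega
  | 1, _, hi => by omega
  | k + 2, hk, hi => by
    rcases Nat.lt_or_ge (i + 1) (k + 1) with hlt | hge
    · have hc : Commute (G i) (G ⟨k + 1, by omega⟩) :=
        h.braid_comm _ _ (by rw [lt_abs]; right; simp only; omega)
      exact (hc.mul_right (h.commute_jm_of_gt i (k + 1) _ hlt)).mul_right hc
    · obtain rfl : k = i := by omega
      have hb := h.braid i ⟨i + 1, by omega⟩ rfl
      have hc := (h.commute_jm_of_lt ⟨i + 1, by omega⟩ i (by omega) (Nat.lt_succ_self _)).eq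
      have hJ : jm G (↑i + 2) hk = G ⟨i + 1, by omega⟩ * (G i * jm G i (by omega) * G i) *
        G ⟨i + 1, by omega⟩ := rfl
      rw [hJ]
      set a := G i
      set b := G ⟨i + 1, by omega⟩
      set j := jm G i (by omega)
      calc a * (b * (a * j * a) * b) = (a * b * a) * j * a * b := by noncomm_ring
        _ = b * a * (b * j) * a * b := by rw [hb]; noncomm_ring
        _ = b * a * j * (b * a * b) := by rw [hc]; noncomm_ring
        _ = (b * (a * j * a) * b) * a := by rw [← hb]; noncomm_ring

end Relations

/-! ### Representations of the algebra -/

section Representations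

variable {A : Type*} [Ring A] [Algebra BaseField A] {d n : ℕ}

theorem smul_incl (r : BaseRing) (y : Y d n) :
    incl d n (r • y) = algebraMap BaseRing BaseField r • incl d n y := by
  rw [map_smul, algebraMap_smul]

theorem mk_e (i : Fin (n - 1)) : incl d n (RingQuot.mkAlgHom BaseRing (Rel d n) (Free.e d i)) =
    idem d (fun j => incl d n (t d j)) i := by
  rw [Free.e, map_smul, smul_incl, ← IsScalarTower.algebraMap_apply, idem]
  simp only [map_sum, map_mul, map_pow]
  rfl

theorem isRep_incl :
    IsRep d (fun i => incl d n (g d i)) (fun j : Fin n => incl d n (t d j)) := by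
  have key : ∀ {a b : Free n}, Rel d n a b → incl d n (RingQuot.mkAlgHom BaseRing (Rel d n) a) =
      incl d n (RingQuot.mkAlgHom BaseRing (Rel d n) b) := fun h => by
    rw [RingQuot.mkAlgHom_rel BaseRing h]
  refine ⟨fun i j h => ?_, fun i j h => ?_, fun i j => ?_, fun i j => ?_, fun j => ?_, fun i => ?_⟩
  · simpa only [map_mul, g, t] using key (Rel.braid_comm i j h)
  · simpa only [map_mul, g, t] using key (Rel.braid i j h)
  · simpa only [map_mul, g, t] using key (Rel.frame_comm i j)
  · simpa only [map_mul, g, t] using key (Rel.frame_braid i j)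
  · simpa only [map_pow, map_one, t] using key (Rel.frame_pow j)
  · have := key (Rel.quadratic (d := d) i)
    rw [map_pow, map_pow, map_add, map_add, map_one, map_one, map_smul, smul_incl,
      algebraMap_qL_sub, map_mul, map_mul, mk_e, sq] at this
    exact this

theorem incl_J (j : Fin n) : incl d n (J d j) = jm (fun i => incl d n (g d i)) j j.2 := by
  suffices h : ∀ (k : ℕ) (hk : k < n), incl d n (jucysMurphyAux d n k hk) =
      jm (fun i => incl d n (g d i)) k hk from h j j.2
  intro k
  induction k with
  | zero => intro hk; simp [jucysMurphyAux, jm]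
  | succ k ih => intro hk; simp [jucysMurphyAux, jm, ih]

theorem map_idem {B : Type*} [Ring B] [Algebra BaseField B] (φ : A →ₐ[BaseField] B)
    (T : Fin n → A) (i : Fin (n - 1)) : φ (idem d T i) = idem d (fun j => φ (T j)) i := by
  simp [idem]

theorem IsRep.map {B : Type*} [Ring B] [Algebra BaseField B] (φ : A →ₐ[BaseField] B)
    {G : Fin (n - 1) → A} {T : Fin n → A} (h : IsRep d G T) :
    IsRep d (fun i => φ (G i)) (fun j => φ (T j)) := by
  refine ⟨fun i j hij => ?_, fun i j hij => ?_, fun i j => ?_, fun i j => ?_, fun j => ?_,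
    fun i => ?_⟩
  · simpa only [map_mul] using congrArg φ (h.braid_comm i j hij)
  · simpa only [map_mul] using congrArg φ (h.braid i j hij)
  · simpa only [map_mul] using congrArg φ (h.frame_comm i j)
  · simpa only [map_mul] using congrArg φ (h.frame_braid i j)
  · simpa only [map_pow, map_one] using congrArg φ (h.frame_pow j)
  · simpa only [map_mul, map_add, map_one, map_smul, map_idem] using congrArg φ (h.quadratic i)

theorem IsRep.exists_algHom {G : Fin (n - 1) → A} {T : Fin n → A} (h : IsRep d G T) :
    ∃ ρ : YK d n →ₐ[BaseField] A, (∀ i, ρ (incl d n (g d i)) = G i) ∧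
      ∀ j, ρ (incl d n (t d j)) = T j := by
  let _ : Algebra BaseRing A := Algebra.compHom A (algebraMap BaseRing BaseField)
  have : IsScalarTower BaseRing BaseField A := IsScalarTower.of_algebraMap_eq fun _ => rfl
  let f : Free n →ₐ[BaseRing] A := FreeAlgebra.lift BaseRing fun
    | .g i => G i
    | .t j => T j
  have hg : ∀ i, f (Free.g i) = G i := fun i => FreeAlgebra.lift_ι_apply _ _
  have ht : ∀ i, f (Free.t i) = T i := fun i => FreeAlgebra.lift_ι_apply _ _
  have hf : ∀ ⦃a b : Free n⦄, Rel d n a b → f a = f b := by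
    intro a b hab
    cases hab with
    | braid_comm i j hij => simpa only [map_mul, hg] using h.braid_comm i j hij
    | braid i j hij => simpa only [map_mul, hg] using h.braid i j hij
    | frame_comm i j => simpa only [map_mul, ht] using h.frame_comm i j
    | frame_braid i j => simpa only [map_mul, ht, hg] using h.frame_braid i j
    | frame_pow j => simpa only [map_pow, map_one, ht] using h.frame_pow j
    | quadratic i =>
      have he : f (Free.e d i) = idem d T i := by
        rw [Free.e, map_smul, ← algebraMap_smul BaseField (algebraMap ℂ BaseRing _),
          ← IsScalarTower.algebraMap_apply, idem]
        simp only [map_sum, map_mul, map_pow, ht]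
      rw [sq, map_add, map_smul, map_mul, map_mul, map_one, hg, he, h.quadratic i,
        ← algebraMap_smul BaseField (qL - qLinv), algebraMap_qL_sub]
  let φ : Y d n →ₐ[BaseRing] A := RingQuot.liftAlgHom BaseRing ⟨f, hf⟩
  have hφ : ∀ a, φ (RingQuot.mkAlgHom BaseRing (Rel d n) a) = f a :=
    fun a => RingQuot.liftAlgHom_mkAlgHom_apply BaseRing f hf a
  let ρ : YK d n →ₐ[BaseField] A := Algebra.TensorProduct.lift (Algebra.ofId BaseField A) φ
    fun x y => Algebra.commutes x (φ y)
  have hρ : ∀ y, ρ (incl d n y) = φ y := fun y => by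
    change Algebra.ofId BaseField A 1 * φ y = φ y
    rw [map_one, one_mul]
  exact ⟨ρ, fun i => by rw [hρ, g, hφ, hg], fun j => by rw [hρ, t, hφ, ht]⟩

end Representations

/-! ### Sets of arrays closed under admissible transpositions -/

/-- The letter is moved to the left by permitted exchanges until a related letter blocks it or it
reaches the initial place. The letters it has not yet passed stay where they were. -/
theorem exists_related_of_swap_mem {n : ℕ} {L : Type*} {R : L → L → Prop} {S : Set (Fin n → L)}
    (hswap : ∀ x ∈ S, ∀ i j : Fin n, (j : ℕ) = i + 1 → ¬ R (x i) (x j) → x ∘ Equiv.swap i j ∈ S)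
    {P : L → Prop} (h0 : ∀ x ∈ S, ∀ j : Fin n, (j : ℕ) = 0 → P (x j)) :
    ∀ (k : ℕ) (hk : k < n), ∀ x ∈ S, P (x ⟨k, hk⟩) ∨ ∃ i < ⟨k, hk⟩, R (x i) (x ⟨k, hk⟩)
  | 0, _, x, hx => Or.inl (h0 x hx _ rfl)
  | k + 1, hk, x, hx => by
    by_cases hR : R (x ⟨k, by omega⟩) (x ⟨k + 1, hk⟩)
    · exact Or.inr ⟨_, Fin.mk_lt_mk.2 (Nat.lt_succ_self k), hR⟩
    · rcases exists_related_of_swap_mem hswap h0 k (by omega) _ (hswap x hx _ _ rfl hR) with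
        h | ⟨i, hi, h⟩
      · left; simpa using h
      · right
        refine ⟨i, hi.trans (Fin.mk_lt_mk.2 (Nat.lt_succ_self k)), ?_⟩
        have hi' : (i : ℕ) < k := hi
        simpa [Equiv.swap_apply_of_ne_of_ne (a := (⟨k, by omega⟩ : Fin n)) (b := ⟨k + 1, hk⟩)
          (x := i) (Fin.ne_of_val_ne hi'.ne) (Fin.ne_of_val_ne (by simp only; omega))] using h

section Combinatorics

variable {d n : ℕ}

/-- Induction on the distance of the two equal letters. An inner neighbour that is not adjacent to
them can be exchanged outwards, which shortens the distance. -/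
theorem exists_between_of_swap_mem {S : Set (Fin n → Fin d × ℤ)}
    (hswap : ∀ x ∈ S, ∀ i j : Fin n, (j : ℕ) = i + 1 → ¬ Adjacent (x i) (x j) →
      x ∘ Equiv.swap i j ∈ S)
    (hne : ∀ x ∈ S, ∀ i j : Fin n, (j : ℕ) = i + 1 → x i ≠ x j)
    (htriple : ∀ x ∈ S, ∀ i j k : Fin n, (j : ℕ) = i + 1 → (k : ℕ) = j + 1 →
      Adjacent (x i) (x j) → x i ≠ x k) :
    ∀ (m : ℕ), ∀ x ∈ S, ∀ i j : Fin n, (j : ℕ) = i + m → i < j → x i = x j →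
      (∃ l, i < l ∧ l < j ∧ x l = ((x i).1, (x i).2 + 1)) ∧
      (∃ l, i < l ∧ l < j ∧ x l = ((x i).1, (x i).2 - 1)) := by
  intro m
  induction m using Nat.strong_induction_on with
  | h m ih =>
    intro x hx i j hm hij h
    have hij' : (i : ℕ) < j := hij
    have hm1 : m ≠ 1 := by rintro rfl; exact hne x hx i j hm h
    obtain ⟨i', hi'⟩ : ∃ i' : Fin n, (i' : ℕ) = i + 1 := ⟨⟨i + 1, by omega⟩, rfl⟩
    obtain ⟨j', hj'⟩ : ∃ j' : Fin n, (j : ℕ) = j' + 1 := ⟨⟨j - 1, by omega⟩, by simp only; omega⟩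
    by_cases hR : Adjacent (x j') (x j)
    · by_cases hL : Adjacent (x i) (x i')
      · have hm2 : m ≠ 2 := by
          rintro rfl
          exact htriple x hx i i' j hi' (by omega) hL h
        have e1 : x i' = ((x i).1, (x i).2 + 1) ∨ x i' = ((x i).1, (x i).2 - 1) := by
          refine hL.2.imp (fun h => Prod.ext hL.1.symm h) fun h => Prod.ext hL.1.symm ?_
          simp only; omega
        have e2 : x j' = ((x i).1, (x i).2 - 1) ∨ x j' = ((x i).1, (x i).2 + 1) := by
          rw [h]
          refine hR.2.imp (fun h => Prod.ext hR.1 ?_) fun h => Prod.ext hR.1 h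
          simp only; omega
        have hii' : i < i' := Fin.lt_def.2 (by omega)
        have hi'j : i' < j := Fin.lt_def.2 (by omega)
        have hij1 : i < j' := Fin.lt_def.2 (by omega)
        have hj'j : j' < j := Fin.lt_def.2 (by omega)
        -- If both inner neighbours are the same letter, induction applied to them produces a
        -- further copy of `x i` strictly between, and induction applies again to this closer pair.
        have key : x i' = x j' → (∃ l, i < l ∧ l < j ∧ x l = ((x i).1, (x i).2 + 1)) ∧
            (∃ l, i < l ∧ l < j ∧ x l = ((x i).1, (x i).2 - 1)) := by
          intro he
          have hbw := ih (m - 2) (by omega) x hx i' j' (by omega) (Fin.lt_def.2 (by omega)) he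
          obtain ⟨l, h1, h2, h3⟩ : ∃ l, i' < l ∧ l < j' ∧ x l = x i := by
            rcases e1 with e1 | e1
            · obtain ⟨l, h1, h2, h3⟩ := hbw.2
              exact ⟨l, h1, h2, by rw [h3, e1]; simp⟩
            · obtain ⟨l, h1, h2, h3⟩ := hbw.1
              exact ⟨l, h1, h2, by rw [h3, e1]; simp⟩
          have h1' : (i' : ℕ) < l := h1
          have h2' : (l : ℕ) < j' := h2
          obtain ⟨⟨u, hu⟩, ⟨w, hw⟩⟩ := ih (l - i) (by omega) x hx i l (by omega)
            (Fin.lt_def.2 (by omega)) h3.symm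
          have hlj : l < j := h2.trans hj'j
          exact ⟨⟨u, hu.1, hu.2.1.trans hlj, hu.2.2⟩, ⟨w, hw.1, hw.2.1.trans hlj, hw.2.2⟩⟩
        rcases e1 with e1 | e1 <;> rcases e2 with e2 | e2
        · exact ⟨⟨i', hii', hi'j, e1⟩, ⟨j', hij1, hj'j, e2⟩⟩
        · exact key (e1.trans e2.symm)
        · exact key (e1.trans e2.symm)
        · exact ⟨⟨j', hij1, hj'j, e2⟩, ⟨i', hii', hi'j, e1⟩⟩
      · have hsw := hswap x hx i i' hi' hL
        have hfix : ∀ l, i' < l → (x ∘ Equiv.swap i i') l = x l := fun l hl => by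
          rw [Function.comp_apply, Equiv.swap_apply_of_ne_of_ne
            (Fin.ne_of_val_ne (by have : (i' : ℕ) < l := hl; omega)) hl.ne']
        have hi1 : (x ∘ Equiv.swap i i') i' = x i := by simp
        have hi'j : i' < j := Fin.lt_def.2 (by omega)
        obtain ⟨⟨u, hu⟩, ⟨w, hw⟩⟩ := ih (m - 1) (by omega) _ hsw i' j (by omega) hi'j
          (by rw [hi1, hfix j hi'j, h])
        rw [hi1] at hu hw
        rw [hfix _ hu.1] at hu
        rw [hfix _ hw.1] at hw
        have hii' : i < i' := Fin.lt_def.2 (by omega)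
        exact ⟨⟨u, hii'.trans hu.1, hu.2⟩, ⟨w, hii'.trans hw.1, hw.2⟩⟩
    · have hsw := hswap x hx j' j hj' hR
      have hfix : ∀ l, l < j' → (x ∘ Equiv.swap j' j) l = x l := fun l hl => by
        rw [Function.comp_apply, Equiv.swap_apply_of_ne_of_ne hl.ne
          (Fin.ne_of_val_ne (by have : (l : ℕ) < j' := hl; omega))]
      have hj1 : (x ∘ Equiv.swap j' j) j' = x j := by simp
      have hij1 : i < j' := Fin.lt_def.2 (by omega)
      obtain ⟨⟨u, hu⟩, ⟨w, hw⟩⟩ := ih (m - 1) (by omega) _ hsw i j' (by omega) hij1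
        (by rw [hj1, hfix i hij1, h])
      rw [hfix i hij1] at hu hw
      rw [hfix _ hu.2.1] at hu
      rw [hfix _ hw.2.1] at hw
      have hj'j : j' < j := Fin.lt_def.2 (by omega)
      exact ⟨⟨u, hu.1, hu.2.1.trans hj'j, hu.2.2⟩, ⟨w, hw.1, hw.2.1.trans hj'j, hw.2.2⟩⟩

/-- An earlier adjacent letter on the side away from `0` also suffices: by induction it is preceded
by a copy of `x j`, which in turn is preceded by the letter sought. -/
theorem exists_pred_of_exists_adjacent {x : Fin n → Fin d × ℤ}
    (hx : ∀ j, (x j).2 ≠ 0 → ∃ i < j, Adjacent (x i) (x j)) (j : Fin n) :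
    (0 < (x j).2 → ∃ i < j, x i = ((x j).1, (x j).2 - 1)) ∧
      ((x j).2 < 0 → ∃ i < j, x i = ((x j).1, (x j).2 + 1)) := by
  induction j using WellFoundedLT.induction with
  | ind j ih =>
    constructor
    · intro hj
      obtain ⟨i, hi, h1, h2⟩ := hx j (by omega)
      rcases h2 with h2 | h2
      · exact ⟨i, hi, Prod.ext h1 (by simp only; omega)⟩
      · obtain ⟨k, hk, h3⟩ := (ih i hi).1 (by omega)
        obtain ⟨l, hl, h4⟩ := (ih k (hk.trans hi)).1 (by rw [h3]; simp only; omega)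
        exact ⟨l, hl.trans (hk.trans hi), by
          rw [h4, h3]; exact Prod.ext h1 (by simp only; omega)⟩
    · intro hj
      obtain ⟨i, hi, h1, h2⟩ := hx j (by omega)
      rcases h2 with h2 | h2
      · obtain ⟨k, hk, h3⟩ := (ih i hi).2 (by omega)
        obtain ⟨l, hl, h4⟩ := (ih k (hk.trans hi)).2 (by rw [h3]; simp only; omega)
        exact ⟨l, hl.trans (hk.trans hi), by
          rw [h4, h3]; exact Prod.ext h1 (by simp only; omega)⟩
      · exact ⟨i, hi, Prod.ext h1 (by simp only; omega)⟩

theorem isContentArray_of_swap_mem {S : Set (Fin n → Fin d × ℤ)}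
    (hswap : ∀ x ∈ S, ∀ i j : Fin n, (j : ℕ) = i + 1 → ¬ Adjacent (x i) (x j) →
      x ∘ Equiv.swap i j ∈ S)
    (hne : ∀ x ∈ S, ∀ i j : Fin n, (j : ℕ) = i + 1 → x i ≠ x j)
    (htriple : ∀ x ∈ S, ∀ i j k : Fin n, (j : ℕ) = i + 1 → (k : ℕ) = j + 1 →
      Adjacent (x i) (x j) → x i ≠ x k)
    (h0 : ∀ x ∈ S, ∀ j : Fin n, (j : ℕ) = 0 → (x j).2 = 0) {x : Fin n → Fin d × ℤ} (hx : x ∈ S) :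
    IsContentArray x := by
  have hadj : ∀ j, (x j).2 ≠ 0 → ∃ i < j, Adjacent (x i) (x j) := fun j hj =>
    (exists_related_of_swap_mem hswap (P := fun a => a.2 = 0) h0 j j.2 x hx).resolve_left hj
  have hbw : ∀ i j : Fin n, i < j → x i = x j →
      (∃ l, i < l ∧ l < j ∧ x l = ((x i).1, (x i).2 + 1)) ∧
      (∃ l, i < l ∧ l < j ∧ x l = ((x i).1, (x i).2 - 1)) := fun i j hij h =>
    exists_between_of_swap_mem hswap hne htriple (j - i) x hx i j
      (by have : (i : ℕ) < j := hij; omega) hij h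
  exact ⟨fun j => (exists_pred_of_exists_adjacent hadj j).1,
    fun j => (exists_pred_of_exists_adjacent hadj j).2,
    fun i j hij h => (hbw i j hij h).1, fun i j hij h => (hbw i j hij h).2⟩

end Combinatorics

/-! ### Linear algebra -/

section Identities

variable {K W : Type*} [Field K] [AddCommGroup W] [Module K W]

theorem smul_sub_smul_sub (a b c : K) (u w : W) :
    a • w - (b * (a - c)) • u - b • c • u = a • (w - b • u) := by module

theorem smul_add_smul_sub (a b c : K) (u w : W) :
    a • w + (b * (c - a)) • u - b • c • u = a • (w - b • u) := by module

end Identities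

section LinearAlgebra

variable {V : Type*} [AddCommGroup V] [Module BaseField V]

/-- The generalised eigenspaces are independent and contain the eigenspaces, which already span;
hence the two families coincide and no Jordan block of size two exists. -/
theorem IsDiagonalisable.eq_zero_of_jordan {f : Module.End BaseField V} (hf : IsDiagonalisable f)
    {μ : BaseField} {u w : V} (hw : f w = μ • w) (hu : f u = μ • u + w) : w = 0 := by
  have hle : (fun ν => f.eigenspace ν) ≤ fun ν => f.maxGenEigenspace ν := fun ν =>
    (f.genEigenspace ν).monotone le_top
  have heq := congrFun ((iSupIndep.le_iff_eq_of_iSup_eq_top f.independent_maxGenEigenspace hf).1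
    hle) μ
  have hmem : u ∈ f.maxGenEigenspace μ := by
    rw [Module.End.mem_maxGenEigenspace]
    refine ⟨2, ?_⟩
    have h1 : (f - μ • 1) u = w := by simp [hu]
    rw [sq, Module.End.mul_apply, h1]
    simp [hw]
  rw [← heq] at hmem
  rw [Module.End.mem_eigenspace_iff, hu] at hmem
  simpa using hmem

theorem adjoin_apply_mem {S : Set (Module.End BaseField V)} {W : Submodule BaseField V}
    (hW : ∀ s ∈ S, ∀ u ∈ W, s u ∈ W) :
    ∀ b ∈ Algebra.adjoin BaseField S, ∀ u ∈ W, b u ∈ W := by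
  intro b hb
  induction hb using Algebra.adjoin_induction with
  | mem s hs => exact hW s hs
  | algebraMap r =>
    intro u hu
    rw [Module.algebraMap_end_apply]
    exact W.smul_mem r hu
  | add a b _ _ ha hb => exact fun u hu => W.add_mem (ha u hu) (hb u hu)
  | mul a b _ _ ha hb => exact fun u hu => ha _ (hb u hu)

/-! ### Invariant subspaces and complete reducibility -/

/-- A subspace that is invariant under `S`, as a module over the algebra generated by `S`. -/
def invariantSubmodule {S : Set (Module.End BaseField V)} (W : Submodule BaseField V)
    (hW : ∀ s ∈ S, ∀ u ∈ W, s u ∈ W) : Submodule (Algebra.adjoin BaseField S) V where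
  carrier := W
  add_mem' := W.add_mem
  zero_mem' := W.zero_mem
  smul_mem' b _ hu := adjoin_apply_mem hW b b.2 _ hu

/-- A module over the algebra generated by `S`, as a vector space. -/
def toSubspace {S : Set (Module.End BaseField V)}
    (N : Submodule (Algebra.adjoin BaseField S) V) : Submodule BaseField V where
  carrier := N
  add_mem' := N.add_mem
  zero_mem' := N.zero_mem
  smul_mem' r _ hu := N.smul_mem (algebraMap BaseField (Algebra.adjoin BaseField S) r) hu

theorem toSubspace_invariant {S : Set (Module.End BaseField V)}
    (N : Submodule (Algebra.adjoin BaseField S) V) :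
    ∀ s ∈ S, ∀ u ∈ toSubspace N, s u ∈ toSubspace N := fun s hs _ hu =>
  N.smul_mem (⟨s, Algebra.subset_adjoin hs⟩ : Algebra.adjoin BaseField S) hu

/-- The cyclic module generated by `u x` lies in `W x`, so by `hirr` each of its nonzero submodules
contains `u x`. It is therefore simple, and these simple modules sum to `V`. -/
theorem isSemisimpleModule_adjoin_of_span {S : Set (Module.End BaseField V)} {ι : Type*}
    (u : ι → V) (hu0 : ∀ x, u x ≠ 0) (hu : Submodule.span BaseField (Set.range u) = ⊤)
    (W : ι → Submodule BaseField V) (hmem : ∀ x, u x ∈ W x)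
    (hinv : ∀ x, ∀ s ∈ S, ∀ w ∈ W x, s w ∈ W x)
    (hirr : ∀ x, ∀ w ∈ W x, w ≠ 0 → ∀ N : Submodule BaseField V,
      (∀ s ∈ S, ∀ w ∈ N, s w ∈ N) → w ∈ N → u x ∈ N) :
    IsSemisimpleModule (Algebra.adjoin BaseField S) V := by
  let p : ι → Submodule (Algebra.adjoin BaseField S) V := fun x => Submodule.span _ {u x}
  have hsimple : ∀ x, IsSimpleModule (Algebra.adjoin BaseField S) (p x) := by
    intro x
    rw [isSimpleModule_iff_isAtom]
    refine ⟨fun h => hu0 x ((Submodule.span_singleton_eq_bot).1 h), fun N hN => ?_⟩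
    by_contra hne
    obtain ⟨w, hw, hw0⟩ := Submodule.exists_mem_ne_zero_of_ne_bot hne
    have hpW : p x ≤ invariantSubmodule (W x) (hinv x) := by
      rw [Submodule.span_singleton_le_iff_mem]
      exact hmem x
    have hux : u x ∈ N :=
      hirr x w (hpW (hN.le hw)) hw0 (toSubspace N) (toSubspace_invariant N) hw
    exact hN.not_ge ((Submodule.span_singleton_le_iff_mem _ _).2 hux)
  refine isSemisimpleModule_of_isSemisimpleModule_submodule' (p := p)
    (fun x => have := hsimple x; inferInstance) ?_
  rw [eq_top_iff]
  intro w _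
  have hle : Submodule.span BaseField (Set.range u) ≤ toSubspace (⨆ x, p x) := by
    rw [Submodule.span_le]
    rintro _ ⟨x, rfl⟩
    exact (le_iSup p x) (Submodule.mem_span_singleton_self (u x))
  exact hle (hu ▸ Submodule.mem_top)

theorem exists_isCompl_of_isSemisimpleModule_adjoin {S : Set (Module.End BaseField V)}
    (hS : IsSemisimpleModule (Algebra.adjoin BaseField S) V) (W : Submodule BaseField V)
    (hW : ∀ s ∈ S, ∀ u ∈ W, s u ∈ W) :
    ∃ W' : Submodule BaseField V, (∀ s ∈ S, ∀ u ∈ W', s u ∈ W') ∧ Disjoint W W' ∧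
      ∀ u, ∃ a ∈ W, ∃ b ∈ W', a + b = u := by
  let N := invariantSubmodule W hW
  obtain ⟨N', hN'⟩ := hS.toComplementedLattice.exists_isCompl N
  refine ⟨toSubspace N', toSubspace_invariant N', ?_, fun u => ?_⟩
  · rw [Submodule.disjoint_def]
    intro u h1 h2
    exact Submodule.disjoint_def.1 hN'.disjoint u h1 h2
  · obtain ⟨a, ha, b, hb, h⟩ := Submodule.mem_sup.1 (hN'.sup_eq_top ▸ Submodule.mem_top (x := u))
    exact ⟨a, ha, b, hb, h⟩

theorem pow_apply_of_apply {f : Module.End BaseField V} {a : BaseField} {u : V}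
    (h : f u = a • u) (m : ℕ) : (f ^ m) u = a ^ m • u := by
  induction m with
  | zero => simp
  | succ m ih => rw [pow_succ, Module.End.mul_apply, h, map_smul, ih, smul_smul, pow_succ, mul_comm]

end LinearAlgebra

/-! ### Common eigenvectors of the Jucys–Murphy elements -/

section JointEigenvectors

variable {V : Type*} [AddCommGroup V] [Module BaseField V] {d n : ℕ}
  {G : Fin (n - 1) → Module.End BaseField V} {T : Fin n → Module.End BaseField V}

/-- The operators through which the algebra generated by `t_i, t_{i+1}, J_i, J_{i+1}, g_i` acts. -/
def localOps (G : Fin (n - 1) → Module.End BaseField V) (T : Fin n → Module.End BaseField V)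
    (i : Fin (n - 1)) : Set (Module.End BaseField V) :=
  {T (left i), T (right i), jm G (left i) (left i).2, jm G (right i) (right i).2, G i}

/-- The vector `v` is a nonzero common eigenvector with the eigenvalues `x`. -/
structure JointEigen (G : Fin (n - 1) → Module.End BaseField V)
    (T : Fin n → Module.End BaseField V) (v : V) (x : Fin n → BaseField × BaseField) : Prop where
  ne_zero : v ≠ 0
  T_apply : ∀ j : Fin n, T j v = (x j).1 • v
  J_apply : ∀ j : Fin n, jm G j j.2 v = (x j).2 • v

/-- The scalar by which `e_i` acts on a common eigenvector of `t_i` and `t_{i+1}`. -/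
def delta (a b : BaseField) : BaseField := open Classical in if a = b then 1 else 0

theorem delta_comm (a b : BaseField) : delta a b = delta b a := by
  simp [delta, eq_comm]

theorem idem_apply (hd : 1 ≤ d) (hT : ∀ j, T j ^ d = 1) (i : Fin (n - 1)) {u : V}
    {a b : BaseField} (ha : T (left i) u = a • u) (hb : T (right i) u = b • u) :
    idem d T i u = delta a b • u := by
  rcases eq_or_ne u 0 with rfl | hu
  · simp
  have hpow : ∀ {j : Fin n} {c : BaseField}, T j u = c • u → c ^ d = 1 := by
    intro j c hc
    have h1 := pow_apply_of_apply hc d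
    rw [hT, Module.End.one_apply] at h1
    have h2 : (c ^ d - 1) • u = 0 := by rw [sub_smul, ← h1, one_smul, sub_self]
    exact sub_eq_zero.1 ((smul_eq_zero.1 h2).resolve_right hu)
  have ha1 := hpow ha
  have hb1 := hpow hb
  have hsum : idem d T i u = (algebraMap ℂ BaseField ((d : ℂ)⁻¹) *
      ∑ s ∈ Finset.range d, a ^ s * b ^ (d - s)) • u := by
    rw [idem, LinearMap.smul_apply, LinearMap.sum_apply, mul_smul, Finset.sum_smul]
    congr 1
    refine Finset.sum_congr rfl fun s _ => ?_
    rw [Module.End.mul_apply, pow_apply_of_apply hb, map_smul, pow_apply_of_apply ha, smul_smul,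
      mul_comm]
  rw [hsum]
  congr 1
  by_cases hab : a = b
  · subst hab
    have : ∀ s ∈ Finset.range d, a ^ s * a ^ (d - s) = 1 := fun s hs => by
      rw [← pow_add, Nat.add_sub_cancel' (Finset.mem_range.1 hs).le, ha1]
    rw [Finset.sum_congr rfl this, delta, if_pos rfl, map_inv₀, map_natCast]
    have hd0 : (d : BaseField) ≠ 0 := by
      rw [← map_natCast (algebraMap ℂ BaseField), Ne, map_eq_zero]
      exact_mod_cast (by omega : d ≠ 0)
    simp [hd0]
  -- For distinct `d`-th roots of unity, the geometric sum times `a - b` is `a ^ d - b ^ d = 0`.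
  · have h0 : ∑ s ∈ Finset.range d, a ^ s * b ^ (d - s) =
        (∑ s ∈ Finset.range d, a ^ s * b ^ (d - 1 - s)) * b := by
      rw [Finset.sum_mul]
      refine Finset.sum_congr rfl fun s hs => ?_
      have := Finset.mem_range.1 hs
      rw [mul_assoc, ← pow_succ]
      congr 2
      omega
    have h1 := (Commute.all a b).geom_sum₂_mul d
    rw [ha1, hb1, sub_self] at h1
    rw [h0, (mul_eq_zero.1 h1).resolve_right (sub_ne_zero.2 hab), delta, if_neg hab]
    simp

theorem IsRep.G_injective (h : IsRep d G T) (i : Fin (n - 1)) : Function.Injective (G i) := by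
  rw [← LinearMap.ker_eq_bot, LinearMap.ker_eq_bot']
  intro u hu
  have := LinearMap.congr_fun (h.quadratic i) u
  simpa [hu] using this.symm

theorem IsRep.jm_injective (h : IsRep d G T) :
    ∀ (k : ℕ) (hk : k < n), Function.Injective (jm G k hk : Module.End BaseField V)
  | 0, _ => fun _ _ h => h
  | k + 1, _ => (h.G_injective _).comp ((h.jm_injective k _).comp (h.G_injective _))

variable {v : V} {x : Fin n → BaseField × BaseField}

theorem JointEigen.snd_ne_zero (hv : JointEigen G T v x) (h : IsRep d G T) (j : Fin n) :
    (x j).2 ≠ 0 := by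
  intro h0
  have := hv.J_apply j
  rw [h0, zero_smul, ← map_zero (jm G j j.2)] at this
  exact hv.ne_zero (h.jm_injective _ _ this)

theorem JointEigen.fst_pow (hv : JointEigen G T v x) (h : IsRep d G T) (j : Fin n) :
    (x j).1 ^ d = 1 := by
  have h1 := pow_apply_of_apply (hv.T_apply j) d
  rw [h.frame_pow, Module.End.one_apply] at h1
  have h2 : ((x j).1 ^ d - 1) • v = 0 := by rw [sub_smul, ← h1, one_smul, sub_self]
  exact sub_eq_zero.1 ((smul_eq_zero.1 h2).resolve_right hv.ne_zero)

theorem JointEigen.snd_zero (hv : JointEigen G T v x) (j : Fin n) (hj : (j : ℕ) = 0) :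
    (x j).2 = 1 := by
  obtain ⟨j, hj'⟩ := j
  obtain rfl : j = 0 := hj
  have h2 : ((x ⟨0, hj'⟩).2 - 1) • v = 0 := by
    rw [sub_smul, ← hv.J_apply, one_smul]
    exact sub_self _
  exact sub_eq_zero.1 ((smul_eq_zero.1 h2).resolve_right hv.ne_zero)

theorem JointEigen.T_G (hv : JointEigen G T v x) (h : IsRep d G T) (i : Fin (n - 1)) (j : Fin n) :
    T j (G i v) = (x (Equiv.swap (left i) (right i) j)).1 • G i v := by
  have := LinearMap.congr_fun (h.frame_braid i j) v
  rwa [Module.End.mul_apply, Module.End.mul_apply, hv.T_apply, map_smul] at this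

theorem JointEigen.G_G (hv : JointEigen G T v x) (hd : 1 ≤ d) (h : IsRep d G T)
    (i : Fin (n - 1)) :
    G i (G i v) = v + (kappa * delta (x (left i)).1 (x (right i)).1) • G i v := by
  have := LinearMap.congr_fun (h.quadratic i) v
  have hl := hv.T_G h i (left i)
  have hr := hv.T_G h i (right i)
  rw [Equiv.swap_apply_left] at hl
  rw [Equiv.swap_apply_right] at hr
  rwa [Module.End.mul_apply, LinearMap.add_apply, LinearMap.smul_apply, Module.End.mul_apply,
    Module.End.one_apply, idem_apply hd h.frame_pow i hl hr, delta_comm, smul_smul] at this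

/-- From `J_{i+1} = g_i J_i g_i`, one has `J_i g_i = g_i⁻¹ J_{i+1}`, and the quadratic relation
gives `g_i⁻¹ = g_i - κ e_i`, where `κ` is `kappa`. -/
theorem JointEigen.J_left_G (hv : JointEigen G T v x) (hd : 1 ≤ d) (h : IsRep d G T)
    (i : Fin (n - 1)) :
    jm G (left i) (left i).2 (G i v) = (x (right i)).2 • G i v -
      (kappa * (x (right i)).2 * delta (x (left i)).1 (x (right i)).1) • v := by
  have h1 := hv.J_apply (right i)
  rw [jm_right, Module.End.mul_apply, Module.End.mul_apply] at h1
  have h2 := LinearMap.congr_fun (h.quadratic i) (jm G (left i) (left i).2 (G i v))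
  rw [Module.End.mul_apply, LinearMap.add_apply, LinearMap.smul_apply, Module.End.mul_apply,
    Module.End.one_apply, h1, map_smul, map_smul,
    idem_apply hd h.frame_pow i (hv.T_apply _) (hv.T_apply _), smul_smul, smul_smul] at h2
  rw [h2, mul_assoc, add_sub_cancel_right]

theorem JointEigen.J_right_G (hv : JointEigen G T v x) (hd : 1 ≤ d) (h : IsRep d G T)
    (i : Fin (n - 1)) :
    jm G (right i) (right i).2 (G i v) = (x (left i)).2 • G i v +
      (kappa * (x (right i)).2 * delta (x (left i)).1 (x (right i)).1) • v := by
  have h1 := hv.J_apply (right i)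
  rw [jm_right, Module.End.mul_apply, Module.End.mul_apply] at h1
  rw [jm_right, Module.End.mul_apply, Module.End.mul_apply, hv.G_G hd h, map_add, map_add,
    map_smul, map_smul, h1, hv.J_apply, map_smul, smul_smul]
  congr 2
  ring

theorem JointEigen.J_G_of_ne (hv : JointEigen G T v x) (h : IsRep d G T) (i : Fin (n - 1))
    {j : Fin n} (hl : j ≠ left i) (hr : j ≠ right i) :
    jm G j j.2 (G i v) = (x j).2 • G i v := by
  have hl' : (j : ℕ) ≠ i := fun h => hl (Fin.ext h)
  have hr' : (j : ℕ) ≠ i + 1 := fun h => hr (Fin.ext h)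
  have hc : Commute (G i) (jm G j j.2) := by
    rcases Nat.lt_or_ge j i with hlt | hge
    · exact h.commute_jm_of_lt i j j.2 hlt
    · exact h.commute_jm_of_gt i j j.2 (by omega)
  have := LinearMap.congr_fun hc.eq v
  rw [Module.End.mul_apply, Module.End.mul_apply, hv.J_apply, map_smul] at this
  exact this.symm

/-! ### Transposed eigenvectors and forbidden patterns -/

/-- The vector `g_i v - b v`, if it is nonzero, has the transposed eigenvalues. -/
theorem JointEigen.swap_of_ne_zero (hv : JointEigen G T v x) (hd : 1 ≤ d) (h : IsRep d G T)
    (i : Fin (n - 1)) {b : BaseField}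
    (hb : b * ((x (right i)).2 - (x (left i)).2) =
      kappa * (x (right i)).2 * delta (x (left i)).1 (x (right i)).1)
    (hb' : (x (left i)).1 ≠ (x (right i)).1 → b = 0) (hne : G i v - b • v ≠ 0) :
    JointEigen G T (G i v - b • v) (x ∘ Equiv.swap (left i) (right i)) := by
  refine ⟨hne, fun j => ?_, fun j => ?_⟩
  · rw [map_sub, map_smul, hv.T_G h, hv.T_apply, smul_sub, smul_comm b]
    congr 1
    by_cases hx : (x (left i)).1 = (x (right i)).1
    · congr 1
      rw [Function.comp_apply]
      rcases eq_or_ne j (left i) with rfl | hl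
      · rw [Equiv.swap_apply_left, hx]
      · rcases eq_or_ne j (right i) with rfl | hr
        · rw [Equiv.swap_apply_right, hx]
        · rw [Equiv.swap_apply_of_ne_of_ne hl hr]
    · simp [hb' hx]
  · rw [map_sub, map_smul, Function.comp_apply]
    rcases eq_or_ne j (left i) with rfl | hl
    · rw [Equiv.swap_apply_left, hv.J_left_G hd h, hv.J_apply, ← hb, smul_sub_smul_sub]
    · rcases eq_or_ne j (right i) with rfl | hr
      · rw [Equiv.swap_apply_right, hv.J_right_G hd h, hv.J_apply, ← hb,
        smul_add_smul_sub]
      · rw [Equiv.swap_apply_of_ne_of_ne hl hr, hv.J_G_of_ne h i hl hr, hv.J_apply, smul_sub,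
          smul_comm b]

/-- For equal columns, `J_i` would act on `g_i v` and `v` by a Jordan block whose off-diagonal entry
`-κ c` is nonzero. -/
theorem JointEigen.ne (hv : JointEigen G T v x) (hd : 1 ≤ d) (h : IsRep d G T)
    (hdiag : ∀ j : Fin n, IsDiagonalisable (jm G j j.2)) (i : Fin (n - 1)) :
    x (left i) ≠ x (right i) := by
  intro hx
  have h1 := hv.J_left_G hd h i
  rw [hx, delta, if_pos rfl, mul_one, sub_eq_add_neg, ← neg_smul] at h1
  have hJ := hv.J_apply (left i)
  rw [hx] at hJ
  have := (hdiag (left i)).eq_zero_of_jordan (by rw [map_smul, hJ, smul_comm]) h1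
  rcases smul_eq_zero.1 this with h0 | h0
  · exact (mul_ne_zero kappa_ne_zero (hv.snd_ne_zero h _)) (neg_eq_zero.1 h0)
  · exact hv.ne_zero h0

/-- Two eigenvalue pairs are related if the first entries agree and the second entries differ by
a factor `q²`. -/
def Related (a b : BaseField × BaseField) : Prop :=
  a.1 = b.1 ∧ (b.2 = q ^ 2 * a.2 ∨ a.2 = q ^ 2 * b.2)

theorem JointEigen.snd_ne (hv : JointEigen G T v x) (hd : 1 ≤ d) (h : IsRep d G T)
    (hdiag : ∀ j : Fin n, IsDiagonalisable (jm G j j.2)) (i : Fin (n - 1))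
    (hx : (x (left i)).1 = (x (right i)).1) : (x (right i)).2 - (x (left i)).2 ≠ 0 :=
  fun h0 => hv.ne hd h hdiag i (Prod.ext hx (sub_eq_zero.1 h0).symm)

theorem JointEigen.exists_swap (hv : JointEigen G T v x) (hd : 1 ≤ d) (h : IsRep d G T)
    (hdiag : ∀ j : Fin n, IsDiagonalisable (jm G j j.2)) (i : Fin (n - 1))
    (hR : ¬ Related (x (left i)) (x (right i))) :
    ∃ w, JointEigen G T w (x ∘ Equiv.swap (left i) (right i)) := by
  by_cases hx : (x (left i)).1 = (x (right i)).1
  · have hne := hv.snd_ne hd h hdiag i hx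
    set b := kappa * (x (right i)).2 / ((x (right i)).2 - (x (left i)).2) with hbdef
    have hb : b * ((x (right i)).2 - (x (left i)).2) = kappa * (x (right i)).2 :=
      div_mul_cancel₀ _ hne
    refine ⟨_, hv.swap_of_ne_zero hd h i (b := b) ?_ (fun h => absurd hx h) ?_⟩
    · rw [hb, delta, if_pos hx, mul_one]
    -- If the transposed vector vanishes, then `b` is an eigenvalue of `g_i`, so `b = q` or `b =
    -- -q⁻¹`. The definition of `b` turns these into the two ratios `q²` and `q⁻²` of a related
    -- pair.
    · intro hw
      rw [sub_eq_zero] at hw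
      have hGG := hv.G_G hd h i
      rw [hw, map_smul, hw, delta, if_pos hx, mul_one, smul_smul, smul_smul] at hGG
      have h2 : (b * b - 1 - kappa * b) • v = 0 := by
        rw [sub_smul, sub_smul, one_smul, hGG]; abel
      have h3 := (smul_eq_zero.1 h2).resolve_right hv.ne_zero
      have hq := q_ne_zero
      have h4 : (b - q) * (b + q⁻¹) = 0 := by
        rw [← h3, kappa]; field_simp; ring
      apply hR
      refine ⟨hx, ?_⟩
      have hk := kappa_ne_zero
      rcases mul_eq_zero.1 h4 with h5 | h5
      · left
        rw [sub_eq_zero.1 h5, kappa] at hb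
        field_simp at hb
        linear_combination hb
      · right
        rw [eq_neg_of_add_eq_zero_left h5, kappa] at hb
        field_simp at hb
        linear_combination hb
  · refine ⟨_, hv.swap_of_ne_zero hd h i (b := 0) ?_ (fun _ => rfl) ?_⟩
    · rw [delta, if_neg hx, mul_zero, zero_mul]
    · rw [zero_smul, sub_zero, ← map_zero (G i)]
      exact fun h0 => hv.ne_zero (h.G_injective i h0)

/-- If the eigenvalues at `i` and `i + 1` are related, then `v` is an eigenvector of `g_i`. -/
theorem JointEigen.G_apply_of_related (hv : JointEigen G T v x) (hd : 1 ≤ d) (h : IsRep d G T)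
    (hdiag : ∀ j : Fin n, IsDiagonalisable (jm G j j.2)) (i : Fin (n - 1))
    (hss : IsSemisimpleModule (Algebra.adjoin BaseField (localOps G T i)) V)
    {b : BaseField} (hx : (x (left i)).1 = (x (right i)).1)
    (hb : b * ((x (right i)).2 - (x (left i)).2) = kappa * (x (right i)).2)
    (hb2 : b * b = 1 + kappa * b) : G i v = b • v := by
  by_contra hne
  have hdelta : delta (x (left i)).1 (x (right i)).1 = 1 := by rw [delta, if_pos hx]
  -- If `w` is nonzero, it spans an invariant line. In an invariant complement, `J_i` separates the
  -- eigenvalues of `v` and `w`, which forces `v`, and then `w`, into the complement.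
  set w := G i v - b • v with hw
  have hw0 : w ≠ 0 := sub_ne_zero.2 hne
  have hjw : JointEigen G T w (x ∘ Equiv.swap (left i) (right i)) :=
    hv.swap_of_ne_zero hd h i (by rw [hb, hdelta, mul_one]) (fun h => absurd hx h) hw0
  have hGw : G i w = (kappa - b) • w := by
    rw [hw, map_sub, map_smul, hv.G_G hd h, hdelta, mul_one, smul_sub, smul_smul]
    have : (kappa - b) * b = -1 := by linear_combination -hb2
    rw [this, neg_smul, one_smul, sub_neg_eq_add, sub_smul]
    abel
  have hinv : ∀ s ∈ localOps G T i, ∀ u ∈ Submodule.span BaseField {w},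
      s u ∈ Submodule.span BaseField {w} := by
    intro s hs u hu
    obtain ⟨r, rfl⟩ := Submodule.mem_span_singleton.1 hu
    rw [map_smul]
    refine Submodule.smul_mem _ _ ?_
    rcases hs with rfl | rfl | rfl | rfl | rfl
    · rw [hjw.T_apply]; exact Submodule.smul_mem _ _ (Submodule.mem_span_singleton_self w)
    · rw [hjw.T_apply]; exact Submodule.smul_mem _ _ (Submodule.mem_span_singleton_self w)
    · rw [hjw.J_apply]; exact Submodule.smul_mem _ _ (Submodule.mem_span_singleton_self w)
    · rw [hjw.J_apply]; exact Submodule.smul_mem _ _ (Submodule.mem_span_singleton_self w)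
    · rw [hGw]; exact Submodule.smul_mem _ _ (Submodule.mem_span_singleton_self w)
  obtain ⟨W', hW', hdisj, hsum⟩ := exists_isCompl_of_isSemisimpleModule_adjoin hss _ hinv
  obtain ⟨a, ha, c, hc, hac⟩ := hsum v
  obtain ⟨r, rfl⟩ := Submodule.mem_span_singleton.1 ha
  have hJw := hjw.J_apply (left i)
  rw [Function.comp_apply, Equiv.swap_apply_left] at hJw
  have hJc : jm G (left i) (left i).2 c ∈ W' := hW' _ (by simp [localOps]) c hc
  have hvW : v ∈ W' := by
    have h1 : jm G (left i) (left i).2 c - (x (right i)).2 • c =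
        ((x (left i)).2 - (x (right i)).2) • v := by
      rw [eq_sub_of_add_eq' hac, map_sub, map_smul, hJw, hv.J_apply, smul_comm r,
        smul_sub _ v (r • w), sub_smul]
      abel
    have h2 := W'.sub_mem hJc (W'.smul_mem (x (right i)).2 hc)
    rw [h1] at h2
    refine (W'.smul_mem_iff ?_).1 h2
    exact sub_ne_zero.2 (sub_ne_zero.1 (hv.snd_ne hd h hdiag i hx)).symm
  have hwW : w ∈ W' := W'.sub_mem (hW' _ (by simp [localOps]) v hvW) (W'.smul_mem b hvW)
  exact hw0 (Submodule.disjoint_def.1 hdisj w (Submodule.mem_span_singleton_self w) hwW)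

theorem JointEigen.G_apply_of_eq_left (hv : JointEigen G T v x) (hd : 1 ≤ d) (h : IsRep d G T)
    (hdiag : ∀ j : Fin n, IsDiagonalisable (jm G j j.2)) (i : Fin (n - 1))
    (hss : IsSemisimpleModule (Algebra.adjoin BaseField (localOps G T i)) V)
    (hx : (x (left i)).1 = (x (right i)).1) (hx2 : (x (right i)).2 = q ^ 2 * (x (left i)).2) :
    G i v = q • v := by
  have hq := q_ne_zero
  refine hv.G_apply_of_related hd h hdiag i hss hx ?_ ?_
  · rw [hx2, kappa]; field_simp
  · rw [kappa]; field_simp; ring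

theorem JointEigen.G_apply_of_eq_right (hv : JointEigen G T v x) (hd : 1 ≤ d) (h : IsRep d G T)
    (hdiag : ∀ j : Fin n, IsDiagonalisable (jm G j j.2)) (i : Fin (n - 1))
    (hss : IsSemisimpleModule (Algebra.adjoin BaseField (localOps G T i)) V)
    (hx : (x (left i)).1 = (x (right i)).1) (hx2 : (x (left i)).2 = q ^ 2 * (x (right i)).2) :
    G i v = (-q⁻¹) • v := by
  have hq := q_ne_zero
  refine hv.G_apply_of_related hd h hdiag i hss hx ?_ ?_
  · rw [hx2, kappa]; field_simp; ring
  · rw [kappa]; field_simp; ring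

/-- In a pattern `a b a`, the neighbouring braid generators act on `v` by `q` and `-q⁻¹`, in one
order or the other. The braid relation then gives `-q = q⁻¹`, that is `q² = -1`. -/
theorem JointEigen.ne_of_related (hv : JointEigen G T v x) (hd : 1 ≤ d) (h : IsRep d G T)
    (hdiag : ∀ j : Fin n, IsDiagonalisable (jm G j j.2))
    (hss : ∀ i, IsSemisimpleModule (Algebra.adjoin BaseField (localOps G T i)) V)
    (i j : Fin (n - 1)) (hij : (j : ℕ) = i + 1) (hR : Related (x (left i)) (x (right i))) :
    x (left i) ≠ x (right j) := by
  intro hx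
  have hl : left j = right i := Fin.ext hij
  have hq := q_ne_zero
  have hbraid := LinearMap.congr_fun (h.braid i j hij) v
  simp only [Module.End.mul_apply] at hbraid
  have key : ∀ {c : BaseField}, c • v = 0 → c = 0 := fun hc =>
    (smul_eq_zero.1 hc).resolve_right hv.ne_zero
  rcases hR with ⟨h1, h2 | h2⟩
  · have e1 := hv.G_apply_of_eq_left hd h hdiag i (hss i) h1 h2
    have e2 := hv.G_apply_of_eq_right hd h hdiag j (hss j) (by rw [hl, ← hx, h1])
      (by rw [hl, ← hx, h2])
    simp only [e1, e2, map_smul, smul_smul] at hbraid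
    have h3 := key (c := q * -q⁻¹ * q - -q⁻¹ * q * -q⁻¹) (by rw [sub_smul, hbraid, sub_self])
    apply q_sq_ne_neg_one
    field_simp at h3
    linear_combination -h3
  · have e1 := hv.G_apply_of_eq_right hd h hdiag i (hss i) h1 h2
    have e2 := hv.G_apply_of_eq_left hd h hdiag j (hss j) (by rw [hl, ← hx, h1])
      (by rw [hl, ← hx, h2])
    simp only [e1, e2, map_smul, smul_smul] at hbraid
    have h3 := key (c := -q⁻¹ * q * -q⁻¹ - q * -q⁻¹ * q) (by rw [sub_smul, hbraid, sub_self])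
    apply q_sq_ne_neg_one
    field_simp at h3
    linear_combination h3

end JointEigenvectors

/-! ### Identities between the matrix coefficients -/

section GenericIdentities

variable {K W : Type*} [Field K] [AddCommGroup W] [Module K W]

theorem div_mul_div_cocycle {x y z : K} (k : K) (hxy : x ≠ y) (hxz : x ≠ z) (hyz : y ≠ z) :
    k * z / (z - x) * (k * x / (x - y)) + k * y / (y - x) * (k * z / (z - y)) =
      k * z / (z - y) * (k * z / (z - x)) := by
  have h1 := sub_ne_zero.2 hxy
  have h2 := sub_ne_zero.2 hxy.symm
  have h3 := sub_ne_zero.2 hxz.symm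
  have h4 := sub_ne_zero.2 hyz.symm
  have h5 : x - y = -(y - x) := by ring
  rw [h5]
  field_simp
  ring

theorem div_mul_div_cocycle' {x y z : K} (k : K) (hxy : x ≠ y) (hxz : x ≠ z) (hyz : y ≠ z) :
    k * y / (y - x) * (k * z / (z - x)) =
      k * z / (z - y) * (k * y / (y - x)) + k * z / (z - x) * (k * y / (y - z)) := by
  have h2 := sub_ne_zero.2 hxy.symm
  have h3 := sub_ne_zero.2 hxz.symm
  have h4 := sub_ne_zero.2 hyz.symm
  have h5 : y - z = -(z - y) := by ring
  rw [h5]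
  field_simp
  ring

theorem div_sub_add_div_sub {x y : K} (k : K) (hxy : x ≠ y) :
    k * y / (y - x) + k * x / (x - y) = k := by
  rw [← neg_sub y x, div_neg, ← sub_eq_add_neg, ← sub_div, ← mul_sub,
    mul_div_cancel_right₀ _ (sub_ne_zero.2 hxy.symm)]

theorem mul_div_sub_add (k x y : K) :
    x * (k * y / (y - x)) + y * (k * x / (x - y)) = 0 := by
  rw [← neg_sub y x, div_neg]
  ring

/-- The braid relation in the seminormal form. -/
theorem braid_apply {P Q : Module.End K W} {e₁₂₃ e₂₁₃ e₁₃₂ e₂₃₁ e₃₁₂ e₃₂₁ : W}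
    {b₁₂ b₂₁ b₁₃ b₂₃ b₃₂ f₁₂ f₂₁ f₁₃ f₂₃ f₃₂ : K}
    (hP₁ : P e₁₂₃ = b₁₂ • e₁₂₃ + f₁₂ • e₂₁₃) (hP₂ : P e₁₃₂ = b₁₃ • e₁₃₂ + f₁₃ • e₃₁₂)
    (hP₃ : P e₂₁₃ = b₂₁ • e₂₁₃ + f₂₁ • e₁₂₃) (hP₄ : P e₂₃₁ = b₂₃ • e₂₃₁ + f₂₃ • e₃₂₁)
    (hQ₁ : Q e₁₂₃ = b₂₃ • e₁₂₃ + f₂₃ • e₁₃₂) (hQ₂ : Q e₁₃₂ = b₃₂ • e₁₃₂ + f₃₂ • e₁₂₃)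
    (hQ₃ : Q e₂₁₃ = b₁₃ • e₂₁₃ + f₁₃ • e₂₃₁) (hQ₄ : Q e₃₁₂ = b₁₂ • e₃₁₂ + f₁₂ • e₃₂₁)
    (h₁₂ : f₁₂ * f₂₁ = 1 + b₁₂ * b₂₁) (h₂₃ : f₂₃ * f₃₂ = 1 + b₂₃ * b₃₂)
    (hB : b₁₃ * b₂₁ + b₁₂ * b₂₃ = b₂₃ * b₁₃) (hB' : b₁₂ * b₁₃ = b₂₃ * b₁₂ + b₁₃ * b₃₂) :
    P (Q (P e₁₂₃)) = Q (P (Q e₁₂₃)) := by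
  simp only [hP₁, hP₂, hP₃, hP₄, hQ₁, hQ₂, hQ₃, hQ₄, map_add, map_smul]
  match_scalars
  · linear_combination b₁₃ * h₁₂ - b₁₃ * h₂₃ + b₁₂ * hB + b₂₃ * hB'
  · linear_combination f₁₂ * hB
  · linear_combination f₂₃ * hB'
  · ring
  · ring
  · ring

/-- The quadratic relation in the seminormal form. -/
theorem quadratic_apply {P : Module.End K W} {u u' : W} {b b' f f' k : K}
    (hu : P u = b • u + f • u') (hu' : P u' = b' • u' + f' • u) (hf : f * f' = 1 + b * b')
    (hb : b + b' = k) : P (P u) = u + k • P u := by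
  simp only [hu, hu', map_add, map_smul]
  match_scalars
  · linear_combination hf + b * hb
  · linear_combination f * hb

theorem mul_mul_apply {P J : Module.End K W} {u u' : W} {b b' f f' c c' : K}
    (hu : P u = b • u + f • u') (hu' : P u' = b' • u' + f' • u) (hJ : J u = c • u)
    (hJ' : J u' = c' • u') (hf : f * f' = 1 + b * b') (hb : c * b + c' * b' = 0) :
    P (J (P u)) = c' • u := by
  simp only [hu, hu', hJ, hJ', map_add, map_smul]
  match_scalars
  · linear_combination c' * hf + b * hb
  · linear_combination f * hb

end GenericIdentities

/-! ### Letters and eigenvalues -/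

section Letters

variable {d : ℕ}

/-- The eigenvalue pair attached to a letter. -/
def eigenpair (ξ : Fin d → ℂ) (a : Fin d × ℤ) : BaseField × BaseField :=
  (algebraMap ℂ BaseField (ξ a.1), q ^ (2 * a.2))

theorem eigenpair_injective {ξ : Fin d → ℂ} (hξ : Function.Injective ξ) :
    Function.Injective (eigenpair ξ) := by
  rintro ⟨p, c⟩ ⟨p', c'⟩ h
  simp only [eigenpair, Prod.mk.injEq] at h
  have h1 := hξ ((algebraMap ℂ BaseField).injective h.1)
  have h2 := q_zpow_injective h.2
  exact Prod.ext h1 (by simp only; omega)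

theorem q_sq_mul_zpow (c : ℤ) : q ^ 2 * q ^ (2 * c) = q ^ (2 * (c + 1)) := by
  rw [mul_add, zpow_add₀ q_ne_zero, mul_comm]
  norm_cast

theorem related_eigenpair {ξ : Fin d → ℂ} (hξ : Function.Injective ξ) {a b : Fin d × ℤ} :
    Related (eigenpair ξ a) (eigenpair ξ b) ↔ Adjacent a b := by
  simp only [Related, eigenpair, Adjacent, q_sq_mul_zpow, q_zpow_eq_zpow,
    (algebraMap ℂ BaseField).injective.eq_iff, hξ.eq_iff]
  refine and_congr_right fun _ => or_congr ?_ ?_ <;> omega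

/-- The diagonal coefficient of `g_i` in the seminormal form. -/
def diagCoeff (a b : Fin d × ℤ) : BaseField :=
  -- This is the value of `b` for which `g_i v - b v` is a common eigenvector.
  if a.1 = b.1 then kappa * q ^ (2 * b.2) / (q ^ (2 * b.2) - q ^ (2 * a.2)) else 0

open Classical in
/-- The off-diagonal coefficient of `g_i` in the seminormal form. -/
def offCoeff (a b : Fin d × ℤ) : BaseField :=
  -- Only the product over the two orders matters, and `(q - b)(q - b') = 1 + b b'` whenever `b + b'
  -- = q - q⁻¹`. The value `0` in both orders for adjacent letters cuts content arrays off from the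
  -- other arrays.
  if Adjacent a b then 0 else if a.1 = b.1 then q - diagCoeff a b else 1

theorem zpow_ne_of_ne {a b : Fin d × ℤ} (hab : a ≠ b) (hp : a.1 = b.1) :
    q ^ (2 * a.2) ≠ q ^ (2 * b.2) := fun h =>
  hab (Prod.ext hp (by have := q_zpow_injective h; omega))

theorem diagCoeff_add {a b : Fin d × ℤ} (hab : a ≠ b) (hp : a.1 = b.1) :
    diagCoeff a b + diagCoeff b a = kappa := by
  rw [diagCoeff, diagCoeff, if_pos hp, if_pos hp.symm]
  exact div_sub_add_div_sub _ (zpow_ne_of_ne hab hp)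

theorem mul_diagCoeff_add (a b : Fin d × ℤ) :
    q ^ (2 * a.2) * diagCoeff a b + q ^ (2 * b.2) * diagCoeff b a = 0 := by
  by_cases hp : a.1 = b.1
  · rw [diagCoeff, diagCoeff, if_pos hp, if_pos hp.symm]
    exact mul_div_sub_add _ _ _
  · rw [diagCoeff, diagCoeff, if_neg hp, if_neg (Ne.symm hp)]
    simp

theorem diagCoeff_of_ne {a b : Fin d × ℤ} (hp : a.1 ≠ b.1) : diagCoeff a b = 0 := if_neg hp

theorem diagCoeff_of_succ {a b : Fin d × ℤ} (hp : a.1 = b.1) (h : b.2 = a.2 + 1) :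
    diagCoeff a b = q := by
  have hne := sub_ne_zero.2 (zpow_ne_of_ne (a := b) (b := a) (by rintro rfl; omega) hp.symm)
  rw [diagCoeff, if_pos hp, div_eq_iff hne, h, ← q_sq_mul_zpow, kappa]
  have := q_ne_zero
  field_simp

theorem diagCoeff_of_adjacent {a b : Fin d × ℤ} (h : Adjacent a b) :
    1 + diagCoeff a b * diagCoeff b a = 0 := by
  have hne : a ≠ b := by rintro rfl; rcases h.2 with h | h <;> omega
  have hadd := diagCoeff_add hne h.1
  have hq := q_ne_zero
  have hqq : q * q⁻¹ = 1 := mul_inv_cancel₀ hq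
  rw [kappa] at hadd
  rcases h.2 with h2 | h2
  · rw [diagCoeff_of_succ h.1 h2] at hadd ⊢
    linear_combination q * hadd - hqq
  · rw [diagCoeff_of_succ h.1.symm h2] at hadd ⊢
    linear_combination q * hadd - hqq

theorem offCoeff_mul {a b : Fin d × ℤ} (hab : a ≠ b) :
    offCoeff a b * offCoeff b a = 1 + diagCoeff a b * diagCoeff b a := by
  by_cases h : Adjacent a b
  · rw [diagCoeff_of_adjacent h, offCoeff, if_pos h, zero_mul]
  · have h' : ¬ Adjacent b a := fun h' => h h'.symm
    rw [offCoeff, offCoeff, if_neg h, if_neg h']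
    by_cases hp : a.1 = b.1
    · rw [if_pos hp, if_pos hp.symm]
      have hadd := diagCoeff_add hab hp
      have hqq : q * q⁻¹ = 1 := mul_inv_cancel₀ q_ne_zero
      rw [kappa] at hadd
      linear_combination -q * hadd + hqq
    · rw [if_neg hp, if_neg (Ne.symm hp), diagCoeff_of_ne hp]
      simp

theorem offCoeff_ne_zero {a b : Fin d × ℤ} (hab : a ≠ b) (h : ¬ Adjacent a b) :
    offCoeff a b ≠ 0 := by
  rw [offCoeff, if_neg h]
  by_cases hp : a.1 = b.1
  · rw [if_pos hp, Ne, sub_eq_zero, diagCoeff, if_pos hp,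
      eq_div_iff (sub_ne_zero.2 (zpow_ne_of_ne hab hp).symm)]
    intro h0
    rw [kappa] at h0
    have hq := q_ne_zero
    field_simp at h0
    have h1 : q ^ 2 * q ^ (2 * a.2) = q ^ (2 * b.2) := by linear_combination -h0
    rw [q_sq_mul_zpow, q_zpow_eq_zpow] at h1
    exact h ⟨hp, Or.inl (by omega)⟩
  · rw [if_neg hp]
    exact one_ne_zero

theorem diagCoeff_cocycle {a b c : Fin d × ℤ} (hab : a ≠ b) (hac : a ≠ c) (hbc : b ≠ c) :
    diagCoeff a c * diagCoeff b a + diagCoeff a b * diagCoeff b c =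
      diagCoeff b c * diagCoeff a c := by
  by_cases h1 : a.1 = b.1
  · by_cases h2 : b.1 = c.1
    · simp only [diagCoeff, if_pos h1, if_pos h1.symm, if_pos h2, if_pos (h1.trans h2)]
      exact div_mul_div_cocycle _ (zpow_ne_of_ne hab h1) (zpow_ne_of_ne hac (h1.trans h2))
        (zpow_ne_of_ne hbc h2)
    · rw [diagCoeff_of_ne h2, diagCoeff_of_ne (h1 ▸ h2)]
      simp
  · rw [diagCoeff_of_ne h1, diagCoeff_of_ne (Ne.symm h1)]
    by_cases h2 : b.1 = c.1
    · rw [diagCoeff_of_ne (show a.1 ≠ c.1 from h2 ▸ h1)]; simp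
    · rw [diagCoeff_of_ne h2]; simp

theorem diagCoeff_cocycle' {a b c : Fin d × ℤ} (hab : a ≠ b) (hac : a ≠ c) (hbc : b ≠ c) :
    diagCoeff a b * diagCoeff a c =
      diagCoeff b c * diagCoeff a b + diagCoeff a c * diagCoeff c b := by
  by_cases h1 : a.1 = b.1
  · by_cases h2 : b.1 = c.1
    · simp only [diagCoeff, if_pos h1, if_pos h2.symm, if_pos h2, if_pos (h1.trans h2)]
      exact div_mul_div_cocycle' _ (zpow_ne_of_ne hab h1) (zpow_ne_of_ne hac (h1.trans h2))
        (zpow_ne_of_ne hbc h2)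
    · rw [diagCoeff_of_ne h2, diagCoeff_of_ne (show a.1 ≠ c.1 from h1 ▸ h2)]
      simp
  · rw [diagCoeff_of_ne h1]
    by_cases h2 : b.1 = c.1
    · rw [diagCoeff_of_ne (show a.1 ≠ c.1 from h2 ▸ h1)]; simp
    · rw [diagCoeff_of_ne (Ne.symm h2)]; simp

end Letters

/-! ### Transpositions of content arrays -/

section Swap

variable {d n : ℕ} {x : Fin n → Fin d × ℤ}

theorem IsContentArray.ne_of_succ (hx : IsContentArray x) {i j : Fin n} (hij : (j : ℕ) = i + 1) :
    x i ≠ x j := by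
  intro h
  obtain ⟨l, h1, h2, -⟩ := hx.up i j (Fin.lt_def.2 (by omega)) h
  rw [Fin.lt_def] at h1 h2
  omega

theorem IsContentArray.ne_of_succ_succ (hx : IsContentArray x) {i j : Fin n}
    (hij : (j : ℕ) = i + 2) : x i ≠ x j := by
  intro h
  obtain ⟨l, h1, h2, h3⟩ := hx.up i j (Fin.lt_def.2 (by omega)) h
  obtain ⟨m, h4, h5, h6⟩ := hx.down i j (Fin.lt_def.2 (by omega)) h
  rw [Fin.lt_def] at h1 h2 h4 h5
  obtain rfl : l = m := Fin.ext (by omega)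
  have := congrArg Prod.snd (h3.symm.trans h6)
  simp only at this
  omega

theorem IsContentArray.snd_eq_zero (hx : IsContentArray x) {j : Fin n} (hj : (j : ℕ) = 0) :
    (x j).2 = 0 := by
  by_contra h
  rcases lt_or_gt_of_ne h with h | h
  · obtain ⟨i, hi, -⟩ := hx.neg j h
    rw [Fin.lt_def] at hi; omega
  · obtain ⟨i, hi, -⟩ := hx.pos j h
    rw [Fin.lt_def] at hi; omega

theorem swap_lt_swap {l r : Fin n} (hlr : (r : ℕ) = l + 1) {a b : Fin n} (hab : a < b)
    (hne : a = l → b ≠ r) : Equiv.swap l r a < Equiv.swap l r b := by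
  rw [Fin.lt_def] at hab ⊢
  simp only [Equiv.swap_apply_def, Fin.ext_iff, ne_eq] at hne ⊢
  split_ifs <;> omega

/-- The conditions involve only the relative order of adjacent or equal letters, whereas the
exchange reverses only one pair, which is neither adjacent nor equal. -/
theorem IsContentArray.comp_swap (hx : IsContentArray x) {l r : Fin n} (hlr : (r : ℕ) = l + 1)
    (hna : ¬ Adjacent (x l) (x r)) : IsContentArray (x ∘ Equiv.swap l r) := by
  have hlt : ∀ {a b}, a < b → Adjacent (x a) (x b) → Equiv.swap l r a < Equiv.swap l r b := by
    intro a b hab hadj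
    refine swap_lt_swap hlr hab ?_
    rintro rfl rfl
    exact hna hadj
  have hpos : ∀ {a b : Fin d × ℤ}, a = (b.1, b.2 - 1) → Adjacent a b := by
    rintro a b rfl; exact ⟨rfl, Or.inl (by simp)⟩
  have hneg : ∀ {a b : Fin d × ℤ}, a = (b.1, b.2 + 1) → Adjacent a b := by
    rintro a b rfl; exact ⟨rfl, Or.inr rfl⟩
  have hord : ∀ a b, Equiv.swap l r a < Equiv.swap l r b → x a = x b → a < b := by
    intro a b hab h
    rcases lt_trichotomy a b with h' | rfl | h'
    · exact h'
    · exact absurd hab (lt_irrefl _)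
    · refine absurd hab (swap_lt_swap hlr h' ?_).not_gt
      rintro rfl rfl
      exact hx.ne_of_succ hlr h.symm
  refine ⟨fun j hj => ?_, fun j hj => ?_, fun i j hij h => ?_, fun i j hij h => ?_⟩
  · obtain ⟨m, hm, h⟩ := hx.pos _ hj
    exact ⟨Equiv.swap l r m, by simpa using hlt hm (hpos h), by simpa using h⟩
  · obtain ⟨m, hm, h⟩ := hx.neg _ hj
    exact ⟨Equiv.swap l r m, by simpa using hlt hm (hneg h), by simpa using h⟩
  · simp only [Function.comp_apply] at h ⊢
    obtain ⟨m, h1, h2, h3⟩ := hx.up _ _ (hord _ _ (by simpa using hij) h) h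
    exact ⟨Equiv.swap l r m, by simpa using hlt h1 (hneg h3).symm,
      by simpa using hlt h2 (hneg (h3.trans (by rw [h]))), by simpa using h3⟩
  · simp only [Function.comp_apply] at h ⊢
    obtain ⟨m, h1, h2, h3⟩ := hx.down _ _ (hord _ _ (by simpa using hij) h) h
    exact ⟨Equiv.swap l r m, by simpa using hlt h1 (hpos h3).symm,
      by simpa using hlt h2 (hpos (h3.trans (by rw [h]))), by simpa using h3⟩

end Swap

/-! ### The seminormal representation -/

section Seminormal

variable {d n : ℕ}

/-- The space with a basis indexed by the content arrays. -/
def SeminormalSpace (d n : ℕ) : Type :=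
  {x : Fin n → Fin d × ℤ // IsContentArray x} →₀ BaseField

instance : AddCommGroup (SeminormalSpace d n) := inferInstanceAs (AddCommGroup (_ →₀ _))

instance : Module BaseField (SeminormalSpace d n) := inferInstanceAs (Module BaseField (_ →₀ _))

/-- The basis of the seminormal representation. -/
def seminormalBasis (d n : ℕ) : Module.Basis {x : Fin n → Fin d × ℤ // IsContentArray x}
    BaseField (SeminormalSpace d n) :=
  ⟨LinearEquiv.refl BaseField (SeminormalSpace d n)⟩

open Classical in
/-- The basis vector of a content array, and `0` for the other arrays. -/
def basisVec (x : Fin n → Fin d × ℤ) : SeminormalSpace d n :=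
  if h : IsContentArray x then seminormalBasis d n ⟨x, h⟩ else 0

theorem basisVec_of_isContentArray {x : Fin n → Fin d × ℤ} (h : IsContentArray x) :
    basisVec x = seminormalBasis d n ⟨x, h⟩ := dif_pos h

theorem basisVec_of_not {x : Fin n → Fin d × ℤ} (h : ¬ IsContentArray x) : basisVec x = 0 :=
  dif_neg h

theorem basisVec_ne_zero {x : Fin n → Fin d × ℤ} (h : IsContentArray x) : basisVec x ≠ 0 := by
  rw [basisVec_of_isContentArray h]
  exact (seminormalBasis d n).ne_zero _

/-- The operator of `t_j` in the seminormal representation. -/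
def semT (ξ : Fin d → ℂ) (j : Fin n) : Module.End BaseField (SeminormalSpace d n) :=
  (seminormalBasis d n).constr BaseField fun x => (eigenpair ξ (x.1 j)).1 • basisVec x.1

/-- The operator of `g_i` in the seminormal representation. -/
def semG (i : Fin (n - 1)) : Module.End BaseField (SeminormalSpace d n) :=
  (seminormalBasis d n).constr BaseField fun x =>
    diagCoeff (x.1 (left i)) (x.1 (right i)) • basisVec x.1 +
      offCoeff (x.1 (left i)) (x.1 (right i)) • basisVec (x.1 ∘ Equiv.swap (left i) (right i))

theorem semT_basisVec (ξ : Fin d → ℂ) (j : Fin n) (x : Fin n → Fin d × ℤ) :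
    semT ξ j (basisVec x) = (eigenpair ξ (x j)).1 • basisVec x := by
  by_cases h : IsContentArray x
  · conv_lhs => rw [basisVec_of_isContentArray h]
    rw [semT, Module.Basis.constr_basis]
  · rw [basisVec_of_not h, map_zero, smul_zero]

/-- The formula also covers arrays that are not content arrays, where `basisVec` is `0`: if the
transposed array is a content array, the letters must be adjacent and the off-diagonal coefficient
vanishes. The relations can then be checked without asking which transposed arrays are content
arrays. -/
theorem semG_basisVec (i : Fin (n - 1)) (x : Fin n → Fin d × ℤ) :
    semG i (basisVec x) = diagCoeff (x (left i)) (x (right i)) • basisVec x +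
      offCoeff (x (left i)) (x (right i)) • basisVec (x ∘ Equiv.swap (left i) (right i)) := by
  by_cases h : IsContentArray x
  · conv_lhs => rw [basisVec_of_isContentArray h]
    rw [semG, Module.Basis.constr_basis]
  · rw [basisVec_of_not h, map_zero, smul_zero, zero_add]
    by_cases h' : IsContentArray (x ∘ Equiv.swap (left i) (right i))
    · have hadj : Adjacent (x (left i)) (x (right i)) := by
        by_contra hna
        apply h
        have := h'.comp_swap (l := left i) (r := right i) rfl
          (by simpa using fun h => hna (Adjacent.symm h))
        rwa [Function.comp_assoc, ← Equiv.coe_trans, Equiv.swap_swap, Equiv.coe_refl,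
          Function.comp_id] at this
      rw [offCoeff, if_pos hadj, zero_smul]
    · rw [basisVec_of_not h', smul_zero]

theorem end_ext {f f' : Module.End BaseField (SeminormalSpace d n)}
    (h : ∀ x : Fin n → Fin d × ℤ, IsContentArray x → f (basisVec x) = f' (basisVec x)) : f = f' := by
  refine (seminormalBasis d n).ext fun x => ?_
  have := h x.1 x.2
  rwa [basisVec_of_isContentArray x.2] at this

theorem span_basisVec : Submodule.span BaseField (Set.range
    fun x : {x : Fin n → Fin d × ℤ // IsContentArray x} => basisVec x.1) = ⊤ := by
  rw [← (seminormalBasis d n).span_eq]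
  congr 2
  funext x
  exact basisVec_of_isContentArray x.2

theorem comp_swap_comp_swap (x : Fin n → Fin d × ℤ) (l r : Fin n) :
    (x ∘ Equiv.swap l r) ∘ Equiv.swap l r = x := by
  funext j; simp

/-- The action of `g_i` on the transposed basis vector. -/
theorem semG_basisVec_swap (i : Fin (n - 1)) (x : Fin n → Fin d × ℤ) :
    semG i (basisVec (x ∘ Equiv.swap (left i) (right i))) =
      diagCoeff (x (right i)) (x (left i)) • basisVec (x ∘ Equiv.swap (left i) (right i)) +
      offCoeff (x (right i)) (x (left i)) • basisVec x := by
  rw [semG_basisVec, comp_swap_comp_swap]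
  simp

theorem idem_basisVec (hd : 1 ≤ d) {ξ : Fin d → ℂ} (hξ : Function.Injective ξ)
    (hT : ∀ j : Fin n, semT ξ j ^ d = 1) (i : Fin (n - 1)) {u : SeminormalSpace d n}
    {a b : Fin d × ℤ} (ha : semT ξ (left i) u = (eigenpair ξ a).1 • u)
    (hb : semT ξ (right i) u = (eigenpair ξ b).1 • u) :
    idem d (semT ξ) i u = (if a.1 = b.1 then 1 else 0 : BaseField) • u := by
  rw [idem_apply hd hT i ha hb, delta]
  simp only [eigenpair, (algebraMap ℂ BaseField).injective.eq_iff, hξ.eq_iff]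

theorem braid_semG (i j : Fin (n - 1)) (hij : (j : ℕ) = i + 1) {x : Fin n → Fin d × ℤ}
    (hx : IsContentArray x) :
    semG i (semG j (semG i (basisVec x))) = semG j (semG i (semG j (basisVec x))) := by
  obtain ⟨l, m, r, hl, hm, hm', hr⟩ : ∃ l m r : Fin n, l = left i ∧ m = right i ∧ m = left j ∧
      r = right j := ⟨_, _, _, rfl, rfl, Fin.ext hij.symm, rfl⟩
  have hlm : (m : ℕ) = l + 1 := by rw [hm, hl]; rfl
  have hmr : (r : ℕ) = m + 1 := by rw [hr, hm']; rfl
  have nlm : l ≠ m := Fin.ne_of_val_ne (by omega)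
  have nlr : l ≠ r := Fin.ne_of_val_ne (by omega)
  have nmr : m ≠ r := Fin.ne_of_val_ne (by omega)
  have hP := fun y : Fin n → Fin d × ℤ => semG_basisVec i y
  have hQ := fun y : Fin n → Fin d × ℤ => semG_basisVec j y
  rw [← hl, ← hm] at hP
  rw [← hm', ← hr] at hQ
  have e1 : Equiv.swap l m r = r := Equiv.swap_apply_of_ne_of_ne nlr.symm nmr.symm
  have e2 : Equiv.swap m r l = l := Equiv.swap_apply_of_ne_of_ne nlm nlr
  -- The two reduced words of the longest permutation of three places lead to the same sixth vector.
  have hlong : ((x ∘ Equiv.swap m r) ∘ Equiv.swap l m) ∘ Equiv.swap m r =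
      ((x ∘ Equiv.swap l m) ∘ Equiv.swap m r) ∘ Equiv.swap l m := by
    funext k
    simp only [Function.comp_apply, Equiv.swap_apply_def]
    congr 1
    split_ifs <;> simp_all
  have d1 := hx.ne_of_succ hlm
  have d2 := hx.ne_of_succ hmr
  have d3 := hx.ne_of_succ_succ (i := l) (j := r) (by omega)
  refine braid_apply (P := semG i) (Q := semG j) (e₁₂₃ := basisVec x)
    (e₂₁₃ := basisVec (x ∘ Equiv.swap l m)) (e₁₃₂ := basisVec (x ∘ Equiv.swap m r))
    (e₂₃₁ := basisVec ((x ∘ Equiv.swap l m) ∘ Equiv.swap m r))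
    (e₃₁₂ := basisVec ((x ∘ Equiv.swap m r) ∘ Equiv.swap l m))
    (e₃₂₁ := basisVec (((x ∘ Equiv.swap l m) ∘ Equiv.swap m r) ∘ Equiv.swap l m))
    (hP x) (by simpa [e1, e2] using hP (x ∘ Equiv.swap m r))
    (by simpa [e1, e2, comp_swap_comp_swap] using hP (x ∘ Equiv.swap l m))
    (by simpa [e1, e2] using hP ((x ∘ Equiv.swap l m) ∘ Equiv.swap m r))
    (hQ x) (by simpa [e1, e2, comp_swap_comp_swap] using hQ (x ∘ Equiv.swap m r))
    (by simpa [e1, e2] using hQ (x ∘ Equiv.swap l m))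
    (by rw [← hlong]; simpa [e1, e2] using hQ ((x ∘ Equiv.swap m r) ∘ Equiv.swap l m))
    (offCoeff_mul d1) (offCoeff_mul d2) (diagCoeff_cocycle d1 d3 d2) (diagCoeff_cocycle' d1 d3 d2)

theorem isRep_seminormal (hd : 1 ≤ d) {ξ : Fin d → ℂ} (hξ : Function.Injective ξ)
    (hξd : ∀ p, ξ p ^ d = 1) : IsRep d (semG : Fin (n - 1) → _) (semT (n := n) ξ) := by
  have hT : ∀ j : Fin n, semT ξ j ^ d = 1 := fun j => end_ext fun x _ => by
    rw [pow_apply_of_apply (semT_basisVec ξ j x), eigenpair, ← map_pow, hξd, map_one, one_smul,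
      Module.End.one_apply]
  have hTG : ∀ (i : Fin (n - 1)) (j : Fin n) (x : Fin n → Fin d × ℤ),
      semT ξ j (semG i (basisVec x)) =
        (eigenpair ξ (x (Equiv.swap (left i) (right i) j))).1 • semG i (basisVec x) := by
    intro i j x
    rw [semG_basisVec, map_add, map_smul, map_smul, semT_basisVec, semT_basisVec, smul_add,
      smul_comm (offCoeff _ _)]
    congr 1
    by_cases hp : (x (left i)).1 = (x (right i)).1
    · have : (x (Equiv.swap (left i) (right i) j)).1 = (x j).1 := by
        rw [Equiv.swap_apply_def]
        split_ifs <;> simp_all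
      rw [smul_comm, eigenpair, eigenpair, this]
    · rw [diagCoeff_of_ne hp, zero_smul, zero_smul, smul_zero]
  refine ⟨fun i j hij => end_ext fun x hx => ?_, fun i j hij => end_ext fun x hx => ?_,
    fun i j => end_ext fun x _ => ?_, fun i j => end_ext fun x _ => ?_, hT,
    fun i => end_ext fun x hx => ?_⟩
  · have h1 : left i ≠ left j := fun h => by
      have : (i : ℕ) = j := congrArg (fun a : Fin n => (a : ℕ)) h
      simp [this] at hij
    have h2 : left i ≠ right j := fun h => by
      have : (i : ℕ) = j + 1 := congrArg (fun a : Fin n => (a : ℕ)) h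
      simp [this] at hij
    have h3 : right i ≠ left j := fun h => by
      have : (i : ℕ) + 1 = j := congrArg (fun a : Fin n => (a : ℕ)) h
      simp [← this] at hij
    have h4 : right i ≠ right j := fun h => by
      have : (i : ℕ) + 1 = j + 1 := congrArg (fun a : Fin n => (a : ℕ)) h
      simp [Nat.succ_injective this] at hij
    have hcomm : (x ∘ Equiv.swap (left i) (right i)) ∘ Equiv.swap (left j) (right j) =
        (x ∘ Equiv.swap (left j) (right j)) ∘ Equiv.swap (left i) (right i) := by
      funext k
      simp only [Function.comp_apply, Equiv.swap_apply_def]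
      congr 1
      split_ifs <;> simp_all
    simp only [Module.End.mul_apply, semG_basisVec, map_add, map_smul, Function.comp_apply,
      Equiv.swap_apply_of_ne_of_ne h1 h2, Equiv.swap_apply_of_ne_of_ne h3 h4,
      Equiv.swap_apply_of_ne_of_ne h1.symm h3.symm, Equiv.swap_apply_of_ne_of_ne h2.symm h4.symm,
      hcomm, smul_add, smul_smul, mul_comm]
    abel
  · exact braid_semG i j hij hx
  · rw [Module.End.mul_apply, Module.End.mul_apply, semT_basisVec, semT_basisVec, map_smul,
      map_smul, semT_basisVec, semT_basisVec, smul_comm]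
  · rw [Module.End.mul_apply, Module.End.mul_apply, semT_basisVec, map_smul, hTG]
  · have hne := hx.ne_of_succ (i := left i) (j := right i) rfl
    have hl := hTG i (left i) x
    have hr := hTG i (right i) x
    rw [Equiv.swap_apply_left] at hl
    rw [Equiv.swap_apply_right] at hr
    rw [Module.End.mul_apply, LinearMap.add_apply, LinearMap.smul_apply, Module.End.one_apply,
      Module.End.mul_apply, idem_basisVec hd hξ hT i hl hr, smul_smul]
    refine quadratic_apply (semG_basisVec i x) (semG_basisVec_swap i x) (offCoeff_mul hne) ?_
    by_cases hp : (x (left i)).1 = (x (right i)).1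
    · rw [if_pos hp.symm, mul_one, diagCoeff_add hne hp]
    · rw [if_neg (Ne.symm hp), mul_zero, diagCoeff_of_ne hp, diagCoeff_of_ne (Ne.symm hp), add_zero]

theorem jm_semG_basisVec (ξ : Fin d → ℂ) : ∀ (k : ℕ) (hk : k < n) (x : Fin n → Fin d × ℤ),
    jm (semG (d := d)) k hk (basisVec x) = (eigenpair ξ (x ⟨k, hk⟩)).2 • basisVec x
  | 0, hk, x => by
    by_cases hx : IsContentArray x
    · rw [eigenpair, hx.snd_eq_zero rfl, mul_zero, zpow_zero, one_smul]
      rfl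
    · rw [basisVec_of_not hx, map_zero, smul_zero]
  | k + 1, hk, x => by
    by_cases hx : IsContentArray x
    · have hr := mul_mul_apply (semG_basisVec ⟨k, by omega⟩ x)
        (semG_basisVec_swap ⟨k, by omega⟩ x) (jm_semG_basisVec ξ k (by omega) x)
        (jm_semG_basisVec ξ k (by omega) _) (offCoeff_mul (hx.ne_of_succ rfl))
        (by
          have : (x ∘ Equiv.swap (left ⟨k, by omega⟩) (right ⟨k, by omega⟩)) ⟨k, by omega⟩ =
            x (right ⟨k, by omega⟩) := congrArg x (Equiv.swap_apply_left _ _)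
          rw [this]
          exact mul_diagCoeff_add _ _)
      refine hr.trans ?_
      congr 3
      exact congrArg x (Equiv.swap_apply_left _ _)
    · rw [basisVec_of_not hx, map_zero, smul_zero]

theorem isDiagonalisable_of_basisVec {f : Module.End BaseField (SeminormalSpace d n)}
    (h : ∀ x : Fin n → Fin d × ℤ, ∃ c : BaseField, f (basisVec x) = c • basisVec x) :
    IsDiagonalisable f := by
  rw [IsDiagonalisable, eq_top_iff, ← span_basisVec, Submodule.span_le]
  rintro _ ⟨x, rfl⟩
  obtain ⟨c, hc⟩ := h x.1
  exact le_iSup (fun μ => f.eigenspace μ) c (Module.End.mem_eigenspace_iff.2 hc)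

theorem isSemisimpleModule_seminormal {ξ : Fin d → ℂ} (hξ : Function.Injective ξ)
    (i : Fin (n - 1)) :
    IsSemisimpleModule (Algebra.adjoin BaseField (localOps (semG (d := d)) (semT ξ) i))
      (SeminormalSpace d n) := by
  let u' : (Fin n → Fin d × ℤ) → SeminormalSpace d n := fun x =>
    offCoeff (x (left i)) (x (right i)) • basisVec (x ∘ Equiv.swap (left i) (right i))
  have hGu : ∀ x, semG i (basisVec x) =
      diagCoeff (x (left i)) (x (right i)) • basisVec x + u' x := fun x => semG_basisVec i x
  have hGu' : ∀ x, semG i (u' x) = diagCoeff (x (right i)) (x (left i)) • u' x +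
      (offCoeff (x (left i)) (x (right i)) * offCoeff (x (right i)) (x (left i))) •
        basisVec x := fun x => by
    simp only [u']
    rw [map_smul, semG_basisVec_swap, smul_add, smul_comm, mul_smul]
  have hT : ∀ j x, semT ξ j (u' x) =
      (eigenpair ξ (x (Equiv.swap (left i) (right i) j))).1 • u' x := fun j x => by
    simp only [u']
    rw [map_smul, semT_basisVec, smul_comm]
    rfl
  have hJ : ∀ (j : Fin n) x, jm (semG (d := d)) j j.2 (u' x) =
      (eigenpair ξ (x (Equiv.swap (left i) (right i) j))).2 • u' x := fun j x => by
    simp only [u']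
    rw [map_smul, jm_semG_basisVec ξ, smul_comm]
    rfl
  refine isSemisimpleModule_adjoin_of_span
    (u := fun x : {x : Fin n → Fin d × ℤ // IsContentArray x} => basisVec x.1)
    (fun x => basisVec_ne_zero x.2) span_basisVec (fun x => Submodule.span BaseField {basisVec x.1, u' x.1})
    (fun x => Submodule.subset_span (Or.inl rfl)) ?_ ?_
  · intro x s hs w hw
    have h1 : basisVec x.1 ∈ Submodule.span BaseField {basisVec x.1, u' x.1} :=
      Submodule.subset_span (Or.inl rfl)
    have h2 : u' x.1 ∈ Submodule.span BaseField {basisVec x.1, u' x.1} :=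
      Submodule.subset_span (Or.inr rfl)
    suffices h : s (basisVec x.1) ∈ Submodule.span BaseField {basisVec x.1, u' x.1} ∧
        s (u' x.1) ∈ Submodule.span BaseField {basisVec x.1, u' x.1} by
      obtain ⟨a, b, rfl⟩ := Submodule.mem_span_pair.1 hw
      rw [map_add, map_smul, map_smul]
      exact add_mem (Submodule.smul_mem _ _ h.1) (Submodule.smul_mem _ _ h.2)
    rcases hs with rfl | rfl | rfl | rfl | rfl
    · rw [semT_basisVec, hT]; exact ⟨Submodule.smul_mem _ _ h1, Submodule.smul_mem _ _ h2⟩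
    · rw [semT_basisVec, hT]; exact ⟨Submodule.smul_mem _ _ h1, Submodule.smul_mem _ _ h2⟩
    · rw [jm_semG_basisVec ξ, hJ]
      exact ⟨Submodule.smul_mem _ _ h1, Submodule.smul_mem _ _ h2⟩
    · rw [jm_semG_basisVec ξ, hJ]
      exact ⟨Submodule.smul_mem _ _ h1, Submodule.smul_mem _ _ h2⟩
    · rw [hGu, hGu']
      exact ⟨add_mem (Submodule.smul_mem _ _ h1) h2,
        add_mem (Submodule.smul_mem _ _ h2) (Submodule.smul_mem _ _ h1)⟩
  · rintro ⟨x, hx⟩ w hw hw0 N hN hwN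
    simp only at hw ⊢
    obtain ⟨a, b, rfl⟩ := Submodule.mem_span_pair.1 hw
    have hne := hx.ne_of_succ (i := left i) (j := right i) rfl
    by_cases hu0 : u' x = 0
    · rw [hu0, smul_zero, add_zero] at hwN hw0
      exact (N.smul_mem_iff (left_ne_zero_of_smul hw0)).1 hwN
    -- The two columns differ, so `t_i` or `J_i` separates the basis vector from the transposed one.
    -- An invariant subspace then contains each component of its vectors.
    · obtain ⟨s, hs, c, c', hcc, hsu, hsu'⟩ : ∃ s ∈ localOps (semG (d := d)) (semT ξ) i,
          ∃ c c' : BaseField, c ≠ c' ∧ s (basisVec x) = c • basisVec x ∧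
            s (u' x) = c' • u' x := by
        by_cases hp : (eigenpair ξ (x (left i))).1 = (eigenpair ξ (x (right i))).1
        · refine ⟨_, Or.inr (Or.inr (Or.inl rfl)), _, _, ?_, jm_semG_basisVec ξ _ _ x, hJ _ x⟩
          rw [Equiv.swap_apply_left]
          exact fun h => hne (eigenpair_injective hξ (Prod.ext hp h))
        · refine ⟨_, Or.inl rfl, _, _, ?_, semT_basisVec ξ _ x, hT _ x⟩
          rwa [Equiv.swap_apply_left]
      have h1 : a • basisVec x ∈ N := by
        have h2 := N.sub_mem (hN s hs _ hwN) (N.smul_mem c' hwN)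
        have h3 : s (a • basisVec x + b • u' x) - c' • (a • basisVec x + b • u' x) =
            (c - c') • a • basisVec x := by
          rw [map_add, map_smul, map_smul, hsu, hsu', smul_add, smul_comm b, smul_comm a, sub_smul]
          abel
        rw [h3] at h2
        exact (N.smul_mem_iff (sub_ne_zero.2 hcc)).1 h2
      -- If only the transposed component is present, `g_i` brings the basis vector back with a
      -- coefficient that is nonzero for letters that are not adjacent.
      by_cases ha : a = 0
      · rw [ha, zero_smul, zero_add] at hwN hw0
        have hu : u' x ∈ N := (N.smul_mem_iff (left_ne_zero_of_smul hw0)).1 hwN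
        have hG := hN (semG i) (by simp [localOps]) _ hu
        rw [hGu'] at hG
        have h2 := (N.add_mem_iff_right (N.smul_mem _ hu)).1 hG
        refine (N.smul_mem_iff ?_).1 h2
        have hna : ¬ Adjacent (x (left i)) (x (right i)) := fun h =>
          hu0 (by simp only [u']; rw [offCoeff, if_pos h, zero_smul])
        exact mul_ne_zero (offCoeff_ne_zero hne hna)
          (offCoeff_ne_zero hne.symm fun h => hna h.symm)
      · exact (N.smul_mem_iff ha).1 h1

end Seminormal

/-! ### The spectrum -/

section Spectrum

variable {d n : ℕ}

theorem map_localSubalgebra {V : Type*} [AddCommGroup V] [Module BaseField V]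
    (ρ : YK d n →ₐ[BaseField] Module.End BaseField V) (i : Fin (n - 1)) :
    (localSubalgebra d i).map ρ = Algebra.adjoin BaseField
      (localOps (fun i => ρ (incl d n (g d i))) (fun j => ρ (incl d n (t d j))) i) := by
  rw [localSubalgebra, AlgHom.map_adjoin, localOps]
  simp only [Set.image_insert_eq, Set.image_singleton, incl_J, map_jm]

theorem mem_spec_of_isContentArray (hd : 1 ≤ d) {ξ : Fin d → ℂ} (hξ : Function.Injective ξ)
    (hξd : ∀ p, ξ p ^ d = 1) {x : Fin n → Fin d × ℤ} (hx : IsContentArray x) :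
    (fun i => (eigenpair ξ (x i)).1, fun i => (eigenpair ξ (x i)).2) ∈ Spec d n := by
  obtain ⟨ρ, hg, ht⟩ := (isRep_seminormal (n := n) hd hξ hξd).exists_algHom
  have hJ : ∀ j : Fin n, ρ (incl d n (J d j)) = jm (semG (d := d)) j j.2 := fun j => by
    rw [incl_J, map_jm, funext hg]
  refine ⟨SeminormalSpace d n, inferInstance, inferInstance, ρ, basisVec x, ⟨?_, ?_, ?_⟩,
    basisVec_ne_zero hx, fun i => ⟨?_, ?_⟩⟩
  · intro i
    rw [ht]
    exact isDiagonalisable_of_basisVec fun x => ⟨_, semT_basisVec ξ i x⟩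
  · intro i
    rw [hJ]
    exact isDiagonalisable_of_basisVec fun x => ⟨_, jm_semG_basisVec ξ i i.2 x⟩
  · intro i
    rw [map_localSubalgebra, funext hg, funext ht]
    exact isSemisimpleModule_seminormal hξ i
  · rw [ht, semT_basisVec]
  · rw [hJ, jm_semG_basisVec ξ]

/-- A primitive `d`-th root of unity of `ℂ` stays primitive in `ℂ(q)`, so its powers exhaust the
solutions there. -/
theorem exists_root_of_pow_eq_one (hd : 1 ≤ d) {a : BaseField} (ha : a ^ d = 1) :
    ∃ z : ℂ, z ^ d = 1 ∧ algebraMap ℂ BaseField z = a := by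
  have : NeZero d := ⟨by omega⟩
  have hprim := Complex.isPrimitiveRoot_exp d (by omega)
  obtain ⟨i, -, hi⟩ := (hprim.map_of_injective
    (algebraMap ℂ BaseField).injective).eq_pow_of_pow_eq_one ha
  exact ⟨_ ^ i, by rw [← pow_mul, mul_comm, pow_mul, hprim.pow_eq_one, one_pow],
    by rw [map_pow, hi]⟩

theorem exists_isContentArray_of_mem_spec (hd : 1 ≤ d) {ξ : Fin d → ℂ}
    (hξ : Function.Injective ξ) (hξs : ∀ z : ℂ, z ^ d = 1 → ∃ p, ξ p = z) {Λ : Array2 n}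
    (hΛ : Λ ∈ Spec d n) : ∃ x : Fin n → Fin d × ℤ, IsContentArray x ∧
      Λ = (fun i => (eigenpair ξ (x i)).1, fun i => (eigenpair ξ (x i)).2) := by
  obtain ⟨V, _, _, ρ, v, hρ, hv0, hv⟩ := hΛ
  set G : Fin (n - 1) → Module.End BaseField V := fun i => ρ (incl d n (g d i)) with hG
  set T : Fin n → Module.End BaseField V := fun j => ρ (incl d n (t d j)) with hT
  have hrep : IsRep d G T := isRep_incl.map ρ
  have hJ : ∀ j : Fin n, ρ (incl d n (J d j)) = jm G j j.2 := fun j => by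
    rw [incl_J, map_jm]
  have hdiag : ∀ j : Fin n, IsDiagonalisable (jm G j j.2) := fun j => hJ j ▸ hρ.diag_J j
  have hss : ∀ i, IsSemisimpleModule (Algebra.adjoin BaseField (localOps G T i)) V := fun i => by
    have := hρ.semisimple i
    rwa [map_localSubalgebra] at this
  -- All eigenvalue arrays of this one representation are treated together, because the exchange
  -- argument leaves the given vector `v`.
  let S : Set (Fin n → BaseField × BaseField) := {y | ∃ w, JointEigen G T w y}
  have hswap : ∀ y ∈ S, ∀ i j : Fin n, (j : ℕ) = i + 1 → ¬ Related (y i) (y j) →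
      y ∘ Equiv.swap i j ∈ S := by
    rintro y ⟨w, hw⟩ i j hij hR
    obtain ⟨k, rfl, rfl⟩ : ∃ k : Fin (n - 1), i = left k ∧ j = right k :=
      ⟨⟨i, by omega⟩, rfl, Fin.ext hij⟩
    exact hw.exists_swap hd hrep hdiag k hR
  -- Each eigenvalue is `1` or differs by a factor `q²` or `q⁻²` from an earlier one, so induction
  -- on the place shows that it is an even power of `q`.
  have hint : ∀ y ∈ S, ∀ j, ∃ m : ℤ, (y j).2 = q ^ (2 * m) := by
    intro y hy j
    induction j using WellFoundedLT.induction with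
    | ind j ih =>
      rcases exists_related_of_swap_mem hswap (P := fun a => a.2 = 1)
        (fun y ⟨w, hw⟩ j hj => hw.snd_zero j hj) j j.2 y hy with h | ⟨i, hi, -, h | h⟩
      · exact ⟨0, by simpa using h⟩
      · obtain ⟨m, hm⟩ := ih i hi
        exact ⟨m + 1, by rw [← q_sq_mul_zpow, ← hm]; exact h⟩
      · obtain ⟨m, hm⟩ := ih i hi
        refine ⟨m - 1, mul_left_cancel₀ (pow_ne_zero 2 q_ne_zero) ?_⟩
        rw [q_sq_mul_zpow, sub_add_cancel, ← hm]
        exact h.symm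
  have hlift : ∀ y ∈ S, ∃ x : Fin n → Fin d × ℤ, y = eigenpair ξ ∘ x := by
    intro y hy
    have : ∀ j, ∃ a, eigenpair ξ a = y j := by
      intro j
      obtain ⟨m, hm⟩ := hint y hy j
      obtain ⟨w, hw⟩ := hy
      obtain ⟨z, hz, hzy⟩ := exists_root_of_pow_eq_one hd (hw.fst_pow hrep j)
      obtain ⟨p, rfl⟩ := hξs z hz
      exact ⟨(p, m), Prod.ext hzy hm.symm⟩
    choose x hx using this
    exact ⟨x, funext fun j => (hx j).symm⟩
  have hΛS : (fun i => (Λ.1 i, Λ.2 i)) ∈ S :=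
    ⟨v, hv0, fun j => (hv j).1, fun j => by rw [← hJ]; exact (hv j).2⟩
  obtain ⟨x, hx⟩ := hlift _ hΛS
  refine ⟨x, ?_, ?_⟩
  · refine isContentArray_of_swap_mem (S := {x | eigenpair ξ ∘ x ∈ S}) ?_ ?_ ?_ ?_
      (show eigenpair ξ ∘ x ∈ S from hx ▸ hΛS)
    · intro x hx i j hij hna
      exact hswap _ hx i j hij fun h => hna ((related_eigenpair hξ).1 h)
    · rintro x ⟨w, hw⟩ i j hij h
      obtain ⟨k, rfl, rfl⟩ : ∃ k : Fin (n - 1), i = left k ∧ j = right k :=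
        ⟨⟨i, by omega⟩, rfl, Fin.ext hij⟩
      exact hw.ne hd hrep hdiag k (congrArg (eigenpair ξ) h)
    · rintro x ⟨w, hw⟩ i j k hij hjk hadj h
      obtain ⟨l, rfl, rfl⟩ : ∃ l : Fin (n - 1), i = left l ∧ j = right l :=
        ⟨⟨i, by omega⟩, rfl, Fin.ext hij⟩
      obtain ⟨m, hml, rfl⟩ : ∃ m : Fin (n - 1), (m : ℕ) = l + 1 ∧ k = right m :=
        ⟨⟨l + 1, by have : ((right l : Fin n) : ℕ) = l + 1 := rfl; omega⟩, rfl, Fin.ext hjk⟩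
      exact hw.ne_of_related hd hrep hdiag hss l m hml ((related_eigenpair hξ).2 hadj)
        (congrArg (eigenpair ξ) h)
    · rintro x ⟨w, hw⟩ j hj
      have h1 : q ^ (2 * (x j).2) = 1 := hw.snd_zero j hj
      by_contra h
      exact q_zpow_ne_one (by omega) h1
  · exact Prod.ext (funext fun i => congrArg Prod.fst (congrFun hx i))
      (funext fun i => congrArg Prod.snd (congrFun hx i))

end Spectrum

end YokonumaHecke

end

theorem proposition5p4 (d n : ℕ) (hd : 1 ≤ d) (ξ : Fin d → ℂ)
    (hξ : Set.BijOn ξ Set.univ {z : ℂ | z ^ d = 1}) :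
    Set.BijOn (fun T : YokonumaHecke.StdTableau d n => T.array ξ) Set.univ
      (YokonumaHecke.Spec d n) := by
  have hinj : Function.Injective ξ := Set.injOn_univ.1 hξ.injOn
  have harr : ∀ T : YokonumaHecke.StdTableau d n, T.array ξ =
      (fun i => (YokonumaHecke.eigenpair ξ (T.letters i)).1,
        fun i => (YokonumaHecke.eigenpair ξ (T.letters i)).2) := fun _ => rfl
  refine ⟨fun T _ => ?_, fun T _ T' _ h => ?_, fun Λ hΛ => ?_⟩
  · exact YokonumaHecke.mem_spec_of_isContentArray hd hinj (fun p => hξ.mapsTo (Set.mem_univ p))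
      T.isContentArray_letters
  · refine YokonumaHecke.StdTableau.letters_injective (funext fun i => ?_)
    simp only [harr, Prod.mk.injEq] at h
    exact YokonumaHecke.eigenpair_injective hinj (Prod.ext (congrFun h.1 i) (congrFun h.2 i))
  · obtain ⟨x, hx, rfl⟩ := YokonumaHecke.exists_isContentArray_of_mem_spec hd hinj
      (fun z hz => by obtain ⟨p, -, hp⟩ := hξ.surjOn hz; exact ⟨p, hp⟩) hΛ
    obtain ⟨T, rfl⟩ := hx.exists_letters_eq
    exact ⟨T, Set.mem_univ _, rfl⟩
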